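/- For every $n\in\mathbb N$ let $\mathcal H_n$ be a finite-dimensional complex Hilbert space (identified with $\mathbb C^{d_n}$, so that operators are matrices), let $\sigma_n$ be a density operator on $\mathcal H_n$, and let $\mathcal N_n=\{\rho_{1,n},\dots,\rho_{r,n}\}$ be density operators on $\mathcal H_n$, where $r\ge 1$ does not depend on $n$. Assume that $\operatorname{supp}\rho_{i,n}\subseteq\operatorname{supp}\sigma_n$ for all $i,n$; no independence or product structure is assumed. Notation. Powers of a positive semidefinite operator are taken on its support only (so $A^0$ is the support projection), $\log 0:=-\infty$, and limsup, liminf, sup, max, min are taken in $[-\infty,+\infty]$. For $t>0$ put $Q_t^{\mathrm{old}}(\rho\|\sigma)=\operatorname{Tr}\rho^t\sigma^{1-t}$ and $Q_t^{\mathrm{new}}(\rho\|\sigma)=\operatorname{Tr}\big(\sigma^{\frac{1-t}{2t}}\rho\,\sigma^{\frac{1-t}{2t}}\big)^t$, and for $t\in(0,1)$ put $D_t^{\mathrm{new}}(\rho\|\sigma)=\frac1{t-1}\log Q_t^{\mathrm{new}}(\rho\|\sigma)-\frac1{t-1}\log\operatorname{Tr}\rho$. A test is an operator $T$ with $0\le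 T\le I$; its errors are $\alpha_n(T)=\sup_{\rho\in\mathcal N_n}\operatorname{Tr}\rho(I-T)$ and $\beta_n(T)=\operatorname{Tr}\sigma_nT$. A real number $R\ge0$ is achievable if there are tests $T_n$ on $\mathcal H_n$ with $\lim_n\alpha_n(T_n)=0$ and $\limsup_n\frac1n\log\beta_n(T_n)\le -R$; the direct rate $R(\{\mathcal N_n\}\|\{\sigma_n\})\in[0,+\infty]$ is the supremum of the achievable rates. For $a\in\mathbb R$ let $S_{n,a}=\{e^{-na}\sum_{i}\rho_{i,n}-\sigma_n>0\}$ (the spectral projection onto the positive part), and put $\psi^{\mathrm{new}}_i(t)=\limsup_n\frac1n\log Q_t^{\mathrm{new}}(\rho_{i,n}\|\sigma_n)$ and $\psi_i^{\mathrm{old}}(t)=\limsup_n\frac1n\log Q_t^{\mathrm{old}}(\rho_{i,n}\|\sigma_n)$. Theorem. (1) For every $a\in\mathbb R$, $$\limsup_{n\to\infty}\tfrac1n\log\alpha_n(S_{n,a})\le-\sup_{0<t<1}\Big\{a(t-1)-\max_{1\le i\le r}\psi_i^{\mathrm{new}}(t)\Big\},$$ $$\limsup_{n\to\infty}\tfrac1n\log\beta_n(S_{n,a})\le-\sup_{0<t<1}\Big\{at-\max_{1\le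 i\le r}\psi_i^{\mathrm{new}}(t)\Big\}\le -a.$$ (2) $$R(\{\mathcal N_n\}\|\{\sigma_n\})\ge\sup_{0<t<1}\min_{1\le i\le r}\liminf_{n\to\infty}\tfrac1nD_t^{\mathrm{new}}(\rho_{i,n}\|\sigma_n).$$ (3) If $\limsup_{n}\frac1n\log\dim\mathcal H_n<+\infty$, then for every $i$ the left derivative $\partial^-\psi_i^{\mathrm{old}}(1)=\lim_{t\nearrow1}\frac{\psi_i^{\mathrm{old}}(t)-\psi_i^{\mathrm{old}}(1)}{t-1}$ exists in $[-\infty,+\infty]$, and $$R(\{\mathcal N_n\}\|\{\sigma_n\})\ge\min_{1\le i\le r}\partial^-\psi_i^{\mathrm{old}}(1).$$ -/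

import Mathlib

open Filter Topology Matrix
open scoped ComplexOrder

/-! Operators on a finite-dimensional Hilbert space are complex matrices over a finite index
type. -/

namespace QHT

noncomputable section

variable {ι : Type*} [Fintype ι] [DecidableEq ι]

/-- The logarithm of a nonnegative real, with `log 0 = -∞`. -/
def elog (x : ℝ) : EReal := ENNReal.log (ENNReal.ofReal x)

/-- The (real) trace of an operator. -/
def rtr (A : Matrix ι ι ℂ) : ℝ := (A.trace).re

/-- Density operators. -/
def IsState (ρ : Matrix ι ι ℂ) : Prop := ρ.PosSemidef ∧ ρ.trace = 1

/-- Tests: operators with `0 ≤ T ≤ I`. -/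
def IsTest (T : Matrix ι ι ℂ) : Prop := T.PosSemidef ∧ (1 - T).PosSemidef

/-- The support of a self-adjoint operator, i.e. its range. -/
def supp (A : Matrix ι ι ℂ) : Submodule ℂ (ι → ℂ) := LinearMap.range A.mulVecLin

/-- The power `A ^ α` of a positive semidefinite operator, taken on the support of `A` only, through
the spectral decomposition of `A`; in particular `A ^ 0` is the projection onto the support.
(The spectrum is finite, so that every function is continuous on it.) -/
def mpow (A : Matrix ι ι ℂ) (α : ℝ) : Matrix ι ι ℂ :=
  cfc (fun x : ℝ => if 0 < x then x ^ α else 0) A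

/-- The spectral projection `{X > 0}` of a self-adjoint operator. -/
def posProj (X : Matrix ι ι ℂ) : Matrix ι ι ℂ :=
  cfc (fun x : ℝ => if 0 < x then (1 : ℝ) else 0) X

/-- `Q_α^{(old)}(ρ‖σ) = Tr ρ^α σ^{1-α}`. -/
def Qold (α : ℝ) (ρ σ : Matrix ι ι ℂ) : ℝ := rtr (mpow ρ α * mpow σ (1 - α))

/-- `Q_α^{(new)}(ρ‖σ) = Tr (σ^{(1-α)/(2α)} ρ σ^{(1-α)/(2α)})^α`. -/
def Qnew (α : ℝ) (ρ σ : Matrix ι ι ℂ) : ℝ :=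
  rtr (mpow (mpow σ ((1 - α) / (2 * α)) * ρ * mpow σ ((1 - α) / (2 * α))) α)

open Classical in
/-- The new (sandwiched) Rényi divergence `D_α^{(new)}(ρ‖σ)`, for `α ∈ (0, ∞) \ {1}`. -/
def Dnew (α : ℝ) (ρ σ : Matrix ι ι ℂ) : EReal :=
  if (0 < α ∧ α < 1) ∨ supp ρ ≤ supp σ then
    (((α - 1)⁻¹ : ℝ) : EReal) * elog (Qnew α ρ σ) - (((α - 1)⁻¹ : ℝ) : EReal) * elog (rtr ρ)
  else ⊤

/-- Type I error: the supremum over the null hypothesis `N` of `Tr ρ (I - T)`. -/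
def typeI (N : Set (Matrix ι ι ℂ)) (T : Matrix ι ι ℂ) : ℝ :=
  sSup ((fun ρ => rtr (ρ * (1 - T))) '' N)

/-- Type II error: `Tr σ T`. -/
def typeII (σ T : Matrix ι ι ℂ) : ℝ := rtr (σ * T)

/-- `limsup_n (1/n) log x_n`, in the extended reals. -/
def limsupRate (x : ℕ → ℝ) : EReal :=
  limsup (fun n : ℕ => (((n : ℝ)⁻¹ : ℝ) : EReal) * elog (x n)) atTop

/-- The one-sided limit of the difference quotients of an extended-real-valued function from the
left at `x` exists in the extended reals and equals `d`. -/
def HasLeftDeriv (f : ℝ → EReal) (x : ℝ) (d : EReal) : Prop :=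
  Tendsto (fun t : ℝ => (f t - f x) / ((t - x : ℝ) : EReal)) (𝓝[<] x) (𝓝 d)

end

noncomputable section

variable {ι : ℕ → Type*} [∀ n, Fintype (ι n)] [∀ n, DecidableEq (ι n)]

/-- Achievability of a rate `R ≥ 0` for the null hypotheses `N n` against `σ n`. -/
def IsAchievable (N : ∀ n, Set (Matrix (ι n) (ι n) ℂ)) (σ : ∀ n, Matrix (ι n) (ι n) ℂ)
    (R : ℝ) : Prop :=
  0 ≤ R ∧ ∃ T : ∀ n, Matrix (ι n) (ι n) ℂ, (∀ n, IsTest (T n)) ∧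
    Tendsto (fun n => typeI (N n) (T n)) atTop (𝓝 0) ∧
    limsupRate (fun n => typeII (σ n) (T n)) ≤ ((-R : ℝ) : EReal)

/-- The direct rate: the supremum in `[0, ∞]` of the achievable rates. -/
def directRate (N : ∀ n, Set (Matrix (ι n) (ι n) ℂ)) (σ : ∀ n, Matrix (ι n) (ι n) ℂ) : EReal :=
  sSup {x : EReal | ∃ R : ℝ, IsAchievable N σ R ∧ x = (R : EReal)}

/-- The Neyman–Pearson test `S_{n,a} = {e^{-na} ∑ i, ρ_{i,n} - σ_n > 0}`. -/
def npTest {r : ℕ} (ρ : Fin r → ∀ n, Matrix (ι n) (ι n) ℂ) (σ : ∀ n, Matrix (ι n) (ι n) ℂ)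
    (n : ℕ) (a : ℝ) : Matrix (ι n) (ι n) ℂ :=
  posProj (Real.exp (-(n * a)) • (∑ i, ρ i n) - σ n)

/-- `ψ_i^{(old)}(t) = limsup_n (1/n) log Q_t^{(old)}(ρ_{i,n}‖σ_n)`, for one sequence `ρ`. -/
def psiOld (ρ σ : ∀ n, Matrix (ι n) (ι n) ℂ) (t : ℝ) : EReal :=
  limsupRate (fun n => Qold t (ρ n) (σ n))

/-- `limsup_n (1/n) log Q_t^{(new)}(ρ_n‖σ_n)`. -/
def psiNew (ρ σ : ∀ n, Matrix (ι n) (ι n) ℂ) (t : ℝ) : EReal :=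
  limsupRate (fun n => Qnew t (ρ n) (σ n))

end

end QHT

set_option linter.unusedSectionVars false

namespace QHT

/-! ### Traces of functions of Hermitian matrices, expanded in eigenbases -/

section Spectral

open scoped MatrixOrder Matrix.Norms.L2Operator

variable {ι : Type*} [Fintype ι] [DecidableEq ι] {A B : Matrix ι ι ℂ}

/-! Everything rests on a one-shot bound: for positive semidefinite `A`, `B` and `0 < t < 1`, the
Neyman–Pearson test `P = {A - B > 0}` satisfies `Tr A(1 - P) + Tr B P ≤ 2 Qnew t A B`
(`posProj_error_le_qnew`). For `t > 1/2` it combines Audenaert's inequality with the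
Araki–Lieb–Thirring inequality `Qold ≤ Qnew`. For `t ≤ 1/2` an explicit spectral projection already
has error at most `2 Qnew`, and the Neyman–Pearson test is optimal.

With `A = e^{-na} ∑ ρ_i` and `B = σ_n`, homogeneity and Rotfel'd's inequality (`qnew_sum_le`) give
`e^{-na} α_n + β_n ≤ 2 e^{-nat} ∑ Qnew t ρ_i σ_n`. Both exponents of (1) can be read off; the bound
`-a` follows as `t → 1`, because `ψ^{new} ≤ 0`. For (2), the test with `a = R` achieves every
nonnegative `R` strictly below the divergence rate, since the bound on `α_n` then decays
exponentially.

For (3), Hölder makes `ψ^{old}(t)/(t - 1)` monotone, and `ψ^{old}(1) = 0` by the support condition,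
so the left derivative is a supremum. A converse Araki–Lieb–Thirring inequality, `Qnew ≤ Qold^t
(dim^{1-t})^{1-t}`, turns bounds on `Qold` into bounds on `Qnew`; its dimension factor has exponent
of order `(1-t)²`, negligible against `1-t` when the dimension grows at most exponentially. -/

theorem continuousOn_spectrum (A : Matrix ι ι ℂ) (f : ℝ → ℝ) : ContinuousOn f (spectrum ℝ A) :=
  A.finite_real_spectrum.continuousOn f

theorem rtr_add (A B : Matrix ι ι ℂ) : rtr (A + B) = rtr A + rtr B := by simp [rtr]

theorem rtr_sub (A B : Matrix ι ι ℂ) : rtr (A - B) = rtr A - rtr B := by simp [rtr]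

theorem rtr_smul (c : ℝ) (A : Matrix ι ι ℂ) : rtr (c • A) = c * rtr A := by simp [rtr]

theorem rtr_sum {κ : Type*} (s : Finset κ) (A : κ → Matrix ι ι ℂ) :
    rtr (∑ i ∈ s, A i) = ∑ i ∈ s, rtr (A i) := by simp [rtr, Matrix.trace_sum]

theorem rtr_mul_comm (A B : Matrix ι ι ℂ) : rtr (A * B) = rtr (B * A) := by
  rw [rtr, Matrix.trace_mul_comm, rtr]

theorem rtr_nonneg (hA : A.PosSemidef) : 0 ≤ rtr A :=
  (Complex.le_def.1 hA.trace_nonneg).1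

theorem rtr_mono (h : A ≤ B) : rtr A ≤ rtr B := by
  have := rtr_nonneg (Matrix.le_iff.1 h)
  rw [rtr_sub] at this
  linarith

theorem rtr_mul_nonneg (hA : A.PosSemidef) (hB : B.PosSemidef) : 0 ≤ rtr (A * B) := by
  obtain ⟨C, rfl⟩ := CStarAlgebra.nonneg_iff_eq_star_mul_self.1 hA.nonneg
  rw [mul_assoc, rtr_mul_comm]
  exact rtr_nonneg (by simpa [Matrix.star_eq_conjTranspose] using hB.mul_mul_conjTranspose_same C)

theorem rtr_mul_le_rtr_mul {C : Matrix ι ι ℂ} (hC : C.PosSemidef) (h : A ≤ B) :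
    rtr (C * A) ≤ rtr (C * B) := by
  have := rtr_mul_nonneg hC (Matrix.le_iff.1 h)
  rw [mul_sub, rtr_sub] at this
  linarith

theorem conj_mono {C : Matrix ι ι ℂ} (hC : C.IsHermitian) (h : A ≤ B) :
    C * A * C ≤ C * B * C := by
  rw [Matrix.le_iff] at h ⊢
  have := h.mul_mul_conjTranspose_same C
  rwa [hC.eq, mul_sub, sub_mul] at this

theorem conj_posSemidef {C : Matrix ι ι ℂ} (hC : C.IsHermitian) (hA : A.PosSemidef) :
    (C * A * C).PosSemidef := by
  have := hA.mul_mul_conjTranspose_same C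
  rwa [hC.eq] at this

theorem conj_posDef {C : Matrix ι ι ℂ} (hC : C.PosDef) (hA : A.PosDef) :
    (C * A * C).PosDef := by
  refine ((conj_posSemidef hC.1 hA.posSemidef).posDef_iff_isUnit).2 ?_
  exact (hC.isUnit.mul hA.isUnit).mul hC.isUnit

theorem cfc_eq_mul_diagonal_mul (hA : A.IsHermitian) (f : ℝ → ℝ) :
    cfc f A = (hA.eigenvectorUnitary : Matrix ι ι ℂ) *
      diagonal (fun i => ((f (hA.eigenvalues i) : ℝ) : ℂ)) *
      (hA.eigenvectorUnitary : Matrix ι ι ℂ)ᴴ := by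
  rw [hA.cfc_eq, IsHermitian.cfc, Unitary.conjStarAlgAut_apply]
  rfl

theorem conjTranspose_mul_eigenvectorUnitary (hA : A.IsHermitian) :
    (hA.eigenvectorUnitary : Matrix ι ι ℂ)ᴴ * (hA.eigenvectorUnitary : Matrix ι ι ℂ) = 1 :=
  Unitary.coe_star_mul_self _

theorem eigenvectorUnitary_mul_conjTranspose (hA : A.IsHermitian) :
    (hA.eigenvectorUnitary : Matrix ι ι ℂ) * (hA.eigenvectorUnitary : Matrix ι ι ℂ)ᴴ = 1 :=
  Unitary.coe_mul_star_self _

theorem rtr_cfc_mul (hA : A.IsHermitian) (f : ℝ → ℝ) (M : Matrix ι ι ℂ) :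
    rtr (cfc f A * M) = ∑ i, f (hA.eigenvalues i) *
      (((hA.eigenvectorUnitary : Matrix ι ι ℂ)ᴴ * M *
        (hA.eigenvectorUnitary : Matrix ι ι ℂ)) i i).re := by
  rw [cfc_eq_mul_diagonal_mul hA, mul_assoc, mul_assoc, rtr_mul_comm, mul_assoc, rtr, Matrix.trace]
  simp [Matrix.diagonal_mul]

theorem rtr_cfc (hA : A.IsHermitian) (f : ℝ → ℝ) :
    rtr (cfc f A) = ∑ i, f (hA.eigenvalues i) := by
  have := rtr_cfc_mul hA f 1
  simpa [conjTranspose_mul_eigenvectorUnitary] using this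

theorem diag_mul_cfc_mul (hB : B.IsHermitian) (g : ℝ → ℝ) (K : Matrix ι ι ℂ) (i : ι) :
    ((K * cfc g B * Kᴴ) i i).re = ∑ j, g (hB.eigenvalues j) *
      Complex.normSq ((K * (hB.eigenvectorUnitary : Matrix ι ι ℂ)) i j) := by
  set V := (hB.eigenvectorUnitary : Matrix ι ι ℂ)
  have : K * cfc g B * Kᴴ = (K * V) * diagonal (fun i => ((g (hB.eigenvalues i) : ℝ) : ℂ)) *
      (K * V)ᴴ := by
    rw [cfc_eq_mul_diagonal_mul hB, conjTranspose_mul]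
    simp only [mul_assoc]
    rfl
  rw [this, Matrix.mul_apply, Complex.re_sum]
  refine Finset.sum_congr rfl fun j _ => ?_
  rw [Matrix.mul_diagonal, conjTranspose_apply]
  simp [Complex.normSq_apply]
  ring

theorem rtr_cfc_mul_cfc (hA : A.IsHermitian) (hB : B.IsHermitian) (f g : ℝ → ℝ)
    (K : Matrix ι ι ℂ) :
    rtr (cfc f A * (K * cfc g B * Kᴴ)) = ∑ i, ∑ j, f (hA.eigenvalues i) * g (hB.eigenvalues j) *
      Complex.normSq (((hA.eigenvectorUnitary : Matrix ι ι ℂ)ᴴ * K *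
        (hB.eigenvectorUnitary : Matrix ι ι ℂ)) i j) := by
  rw [rtr_cfc_mul hA]
  refine Finset.sum_congr rfl fun i _ => ?_
  have := diag_mul_cfc_mul hB g ((hA.eigenvectorUnitary : Matrix ι ι ℂ)ᴴ * K) i
  rw [conjTranspose_mul, conjTranspose_conjTranspose] at this
  rw [show (hA.eigenvectorUnitary : Matrix ι ι ℂ)ᴴ * (K * cfc g B * Kᴴ) *
    (hA.eigenvectorUnitary : Matrix ι ι ℂ) = (hA.eigenvectorUnitary : Matrix ι ι ℂ)ᴴ * K *
      cfc g B * (Kᴴ * (hA.eigenvectorUnitary : Matrix ι ι ℂ)) by simp only [mul_assoc], this,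
    Finset.mul_sum]
  exact Finset.sum_congr rfl fun j _ => by ring

theorem sum_normSq_row {W : Matrix ι ι ℂ} (hW : W * Wᴴ = 1) (i : ι) :
    ∑ j, Complex.normSq (W i j) = 1 := by
  have := congrFun (congrFun hW i) i
  rw [Matrix.mul_apply, Matrix.one_apply_eq] at this
  have h2 := congrArg Complex.re this
  simpa [Complex.normSq_apply] using h2

theorem sum_normSq_col {W : Matrix ι ι ℂ} (hW : Wᴴ * W = 1) (j : ι) :
    ∑ i, Complex.normSq (W i j) = 1 := by
  have := congrFun (congrFun hW j) j
  rw [Matrix.mul_apply, Matrix.one_apply_eq] at this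
  have h2 := congrArg Complex.re this
  simpa [Complex.normSq_apply] using h2

/-- Squared moduli of the overlaps of two eigenbases. -/
noncomputable def overlap (hA : A.IsHermitian) (hB : B.IsHermitian) (i j : ι) : ℝ :=
  Complex.normSq (((hA.eigenvectorUnitary : Matrix ι ι ℂ)ᴴ *
    (hB.eigenvectorUnitary : Matrix ι ι ℂ)) i j)

theorem overlap_nonneg (hA : A.IsHermitian) (hB : B.IsHermitian) (i j : ι) :
    0 ≤ overlap hA hB i j := Complex.normSq_nonneg _

/-- The overlaps are doubly stochastic, so a trace involving one operator also expands as a double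
sum and can be compared termwise with traces of products. -/
theorem sum_overlap_right (hA : A.IsHermitian) (hB : B.IsHermitian) (i : ι) :
    ∑ j, overlap hA hB i j = 1 := by
  refine sum_normSq_row ?_ i
  rw [conjTranspose_mul, conjTranspose_conjTranspose, ← mul_assoc, mul_assoc _ _ (_)ᴴ,
    eigenvectorUnitary_mul_conjTranspose, mul_one, conjTranspose_mul_eigenvectorUnitary]

theorem sum_overlap_left (hA : A.IsHermitian) (hB : B.IsHermitian) (j : ι) :
    ∑ i, overlap hA hB i j = 1 := by
  refine sum_normSq_col ?_ j
  rw [conjTranspose_mul, conjTranspose_conjTranspose, ← mul_assoc,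
    mul_assoc _ (hA.eigenvectorUnitary : Matrix ι ι ℂ),
    eigenvectorUnitary_mul_conjTranspose, mul_one, conjTranspose_mul_eigenvectorUnitary]

theorem rtr_cfc_mul_cfc' (hA : A.IsHermitian) (hB : B.IsHermitian) (f g : ℝ → ℝ) :
    rtr (cfc f A * cfc g B) = ∑ i, ∑ j, f (hA.eigenvalues i) * g (hB.eigenvalues j) *
      overlap hA hB i j := by
  have := rtr_cfc_mul_cfc hA hB f g 1
  simpa [overlap] using this

/-- `Tr f(A)` is a sum of `f` over the roots of the characteristic polynomial. As `CD` and `DC`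
share that polynomial, factors may be swapped under `Tr f`. -/
theorem rtr_cfc_eq_of_charpoly (hA : A.IsHermitian) (hB : B.IsHermitian)
    (h : A.charpoly = B.charpoly) (f : ℝ → ℝ) : rtr (cfc f A) = rtr (cfc f B) := by
  have key : ∀ {C : Matrix ι ι ℂ} (hC : C.IsHermitian),
      rtr (cfc f C) = (C.charpoly.roots.map (fun z => f z.re)).sum := by
    intro C hC
    rw [rtr_cfc hC, hC.roots_charpoly_eq_eigenvalues, Multiset.map_map]
    rfl
  rw [key hA, key hB, h]

theorem rtr_cfc_mul_comm {C D : Matrix ι ι ℂ} (h1 : (C * D).IsHermitian) (h2 : (D * C).IsHermitian)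
    (f : ℝ → ℝ) : rtr (cfc f (C * D)) = rtr (cfc f (D * C)) :=
  rtr_cfc_eq_of_charpoly h1 h2 (Matrix.charpoly_mul_comm _ _) f

end Spectral

/-! ### Powers on the support: algebra, monotonicity, continuity -/

section Powers

open scoped MatrixOrder Matrix.Norms.L2Operator

variable {ι : Type*} [Fintype ι] [DecidableEq ι] {A B : Matrix ι ι ℂ}

theorem spectrum_nonneg (hA : A.PosSemidef) {x : ℝ} (hx : x ∈ spectrum ℝ A) : 0 ≤ x :=
  spectrum_nonneg_of_nonneg hA.nonneg hx

theorem spectrum_pos (hA : A.PosDef) {x : ℝ} (hx : x ∈ spectrum ℝ A) : 0 < x := by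
  rw [hA.1.spectrum_real_eq_range_eigenvalues] at hx
  obtain ⟨i, rfl⟩ := hx
  exact hA.eigenvalues_pos i

theorem cfc_isHermitian (f : ℝ → ℝ) (A : Matrix ι ι ℂ) : (cfc f A).IsHermitian :=
  cfc_predicate f A

theorem cfc_id_of_isHermitian (hA : A.IsHermitian) : cfc (id : ℝ → ℝ) A = A :=
  cfc_id ℝ A hA.isSelfAdjoint

theorem mpow_isHermitian (A : Matrix ι ι ℂ) (α : ℝ) : (mpow A α).IsHermitian :=
  cfc_isHermitian _ _

theorem mpow_posSemidef (A : Matrix ι ι ℂ) (α : ℝ) : (mpow A α).PosSemidef := by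
  refine Matrix.nonneg_iff_posSemidef.1 (cfc_nonneg fun x _ => ?_)
  split_ifs with h
  · exact (Real.rpow_pos_of_pos h _).le
  · exact le_rfl

theorem mpow_mul_mpow (A : Matrix ι ι ℂ) (a b : ℝ) : mpow A a * mpow A b = mpow A (a + b) := by
  unfold mpow
  rw [← cfc_mul _ _ A (continuousOn_spectrum _ _) (continuousOn_spectrum _ _)]
  refine cfc_congr fun x _ => ?_
  by_cases h : 0 < x
  · simp [h, Real.rpow_add h]
  · simp [h]

theorem mpow_mpow (hA : A.IsHermitian) (a b : ℝ) : mpow (mpow A a) b = mpow A (a * b) := by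
  unfold mpow
  rw [← cfc_comp' _ _ A ((A.finite_real_spectrum.image _).continuousOn _)
    (continuousOn_spectrum _ _) hA.isSelfAdjoint]
  refine cfc_congr fun x _ => ?_
  by_cases h : 0 < x
  · simp [h, Real.rpow_pos_of_pos h, Real.rpow_mul h.le]
  · simp [h]

theorem mpow_one (hA : A.PosSemidef) : mpow A 1 = A := by
  unfold mpow
  conv_rhs => rw [← cfc_id ℝ A hA.1.isSelfAdjoint]
  refine cfc_congr fun x hx => ?_
  have := spectrum_nonneg hA hx
  by_cases h : 0 < x
  · simp [h]
  · simp [le_antisymm (not_lt.1 h) this]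

theorem mpow_zero_of_posDef (hA : A.PosDef) : mpow A 0 = 1 := by
  unfold mpow
  rw [← cfc_one ℝ A hA.1.isSelfAdjoint]
  exact cfc_congr fun x hx => by simp [spectrum_pos hA hx]

theorem mpow_posDef (hA : A.PosDef) (α : ℝ) : (mpow A α).PosDef := by
  refine (mpow_posSemidef A α).posDef_iff_isUnit.2 ?_
  have : mpow A α * mpow A (-α) = 1 := by
    rw [mpow_mul_mpow, add_neg_cancel, mpow_zero_of_posDef hA]
  exact IsUnit.of_mul_eq_one _ this

theorem mpow_eq_rpow (hA : A.PosSemidef) {α : ℝ} (hα : 0 < α) : mpow A α = A ^ α := by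
  rw [CFC.rpow_eq_cfc_real (ha := hA.nonneg)]
  refine cfc_congr fun x hx => ?_
  have := spectrum_nonneg hA hx
  by_cases h : 0 < x
  · simp [h]
  · simp [le_antisymm (not_lt.1 h) this, Real.zero_rpow hα.ne']

theorem mpow_le_mpow (hA : A.PosSemidef) (hAB : A ≤ B) {α : ℝ} (h0 : 0 < α) (h1 : α ≤ 1) :
    mpow A α ≤ mpow B α := by
  have hB : B.PosSemidef := Matrix.nonneg_iff_posSemidef.1 (hA.nonneg.trans hAB)
  rw [mpow_eq_rpow hA h0, mpow_eq_rpow hB h0]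
  exact CFC.rpow_le_rpow ⟨h0.le, h1⟩ hAB

theorem mpow_smul (hA : A.PosSemidef) {c : ℝ} (hc : 0 < c) (α : ℝ) :
    mpow (c • A) α = (c ^ α) • mpow A α := by
  unfold mpow
  rw [← cfc_comp_smul c _ A ((A.finite_real_spectrum.image _).continuousOn _) hA.1.isSelfAdjoint,
    ← cfc_smul _ _ A (continuousOn_spectrum _ _)]
  refine cfc_congr fun x hx => ?_
  have hx := spectrum_nonneg hA hx
  by_cases h : 0 < x
  · simp [h, hc, Real.mul_rpow hc.le hx]
  · simp [le_antisymm (not_lt.1 h) hx]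

theorem mpow_continuous {X : Type*} [TopologicalSpace X] {a : X → Matrix ι ι ℂ}
    (ha : Continuous a) (h : ∀ x, (a x).IsHermitian) {α : ℝ} (hα : 0 < α) :
    Continuous fun x => mpow (a x) α := by
  have hf : Continuous fun x : ℝ => if 0 < x then x ^ α else 0 := by
    have : (fun x : ℝ => if 0 < x then x ^ α else 0) = fun x => (max x 0) ^ α := by
      funext x
      split_ifs with h
      · rw [max_eq_left h.le]
      · rw [max_eq_right (not_lt.1 h), Real.zero_rpow hα.ne']
    rw [this]
    exact (continuous_id.max continuous_const).rpow_const fun _ => Or.inr hα.le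
  exact Continuous.cfc_of_mem_nhdsSet _ (s := Set.univ) Filter.univ_mem ha h hf.continuousOn

theorem add_smul_one_posDef (hA : A.PosSemidef) {ε : ℝ} (hε : 0 < ε) : (A + ε • 1).PosDef :=
  Matrix.PosDef.posSemidef_add hA (Matrix.PosDef.one.smul hε)

theorem rtr_continuous {X : Type*} [TopologicalSpace X] {a : X → Matrix ι ι ℂ}
    (ha : Continuous a) : Continuous fun x => rtr (a x) :=
  Complex.continuous_re.comp ha.matrix_trace

theorem qnew_continuous {a b : ℝ → Matrix ι ι ℂ} (ha : Continuous a) (hb : Continuous b)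
    (ha' : ∀ x, (a x).IsHermitian) (hb' : ∀ x, (b x).IsHermitian) {t : ℝ} (h0 : 0 < t)
    (h1 : t < 1) : Continuous fun x => Qnew t (a x) (b x) := by
  have hpos : 0 < (1 - t) / (2 * t) := div_pos (by linarith) (by linarith)
  have hK := mpow_continuous hb hb' hpos
  refine rtr_continuous (mpow_continuous ((hK.mul ha).mul hK) (fun x => ?_) h0)
  have := isHermitian_mul_mul_conjTranspose (mpow (b x) ((1 - t) / (2 * t))) (ha' x)
  rwa [(mpow_isHermitian _ _).eq] at this

/-- An inequality between continuous functions at `0` may be checked at positive arguments. -/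
theorem le_of_perturb_le {f g : ℝ → ℝ} (hf : Continuous f) (hg : Continuous g)
    (h : ∀ ε > 0, f ε ≤ g ε) : f 0 ≤ g 0 := by
  have hf' : Tendsto f (𝓝[>] 0) (𝓝 (f 0)) := hf.continuousAt.tendsto.mono_left nhdsWithin_le_nhds
  have hg' : Tendsto g (𝓝[>] 0) (𝓝 (g 0)) := hg.continuousAt.tendsto.mono_left nhdsWithin_le_nhds
  exact le_of_tendsto_of_tendsto hf' hg' (eventually_nhdsWithin_of_forall h)

theorem perturb_continuous (A : Matrix ι ι ℂ) : Continuous fun ε : ℝ => A + ε • 1 := by fun_prop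

theorem perturb_isHermitian (hA : A.IsHermitian) (ε : ℝ) : (A + ε • 1).IsHermitian :=
  hA.add (IsSelfAdjoint.smul (IsSelfAdjoint.all ε) isHermitian_one)

theorem rtr_mpow_conj_comm {C : Matrix ι ι ℂ} (α : ℝ) :
    rtr (mpow (Cᴴ * C) α) = rtr (mpow (C * Cᴴ) α) :=
  rtr_cfc_mul_comm (isHermitian_conjTranspose_mul_self C) (isHermitian_mul_conjTranspose_self C) _

theorem rtr_mpow_nonneg (A : Matrix ι ι ℂ) (α : ℝ) : 0 ≤ rtr (mpow A α) :=
  rtr_nonneg (mpow_posSemidef A α)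

theorem rtr_mpow (hA : A.PosSemidef) {α : ℝ} (hα : 0 < α) :
    rtr (mpow A α) = ∑ i, hA.1.eigenvalues i ^ α := by
  rw [mpow, rtr_cfc hA.1]
  refine Finset.sum_congr rfl fun i _ => ?_
  split_ifs with h
  · rfl
  · rw [le_antisymm (not_lt.1 h) (hA.eigenvalues_nonneg i), Real.zero_rpow hα.ne']

/-- Trace form of Young's inequality. -/
theorem rtr_mpow_le_young (hA : A.PosSemidef) (hB : B.PosDef) {t : ℝ} (h0 : 0 < t) (h1 : t < 1) :
    rtr (mpow A t) ≤ t * rtr (A * B) + (1 - t) * rtr (mpow B (-(t / (1 - t)))) := by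
  have hs : (1 - t) ≠ 0 := by linarith
  have e1 : rtr (mpow A t) = ∑ i, ∑ j, hA.1.eigenvalues i ^ t * overlap hA.1 hB.1 i j := by
    rw [rtr_mpow hA h0]
    exact Finset.sum_congr rfl fun i _ => by rw [← Finset.mul_sum, sum_overlap_right, mul_one]
  have e2 : rtr (A * B) = ∑ i, ∑ j, hA.1.eigenvalues i * hB.1.eigenvalues j *
      overlap hA.1 hB.1 i j := by
    have := rtr_cfc_mul_cfc' hA.1 hB.1 id id
    rwa [cfc_id_of_isHermitian hA.1, cfc_id_of_isHermitian hB.1] at this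
  have e3 : rtr (mpow B (-(t / (1 - t)))) = ∑ i, ∑ j, hB.1.eigenvalues j ^ (-(t / (1 - t))) *
      overlap hA.1 hB.1 i j := by
    rw [Finset.sum_comm, mpow, rtr_cfc hB.1]
    refine Finset.sum_congr rfl fun i _ => ?_
    rw [← Finset.mul_sum, sum_overlap_left, mul_one, if_pos (hB.eigenvalues_pos i)]
  rw [e1, e2, e3, Finset.mul_sum, Finset.mul_sum, ← Finset.sum_add_distrib]
  refine Finset.sum_le_sum fun i _ => ?_
  rw [Finset.mul_sum, Finset.mul_sum, ← Finset.sum_add_distrib]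
  refine Finset.sum_le_sum fun j _ => ?_
  have hx := hA.eigenvalues_nonneg i
  have hy := hB.eigenvalues_pos j
  -- Weighted AM-GM for `x y` and `y^(-t/(1-t))`: the powers of `y` cancel in the geometric mean,
  -- leaving `x^t`.
  have key := Real.geom_mean_le_arith_mean2_weighted h0.le (by linarith : 0 ≤ 1 - t)
    (mul_nonneg hx hy.le) (Real.rpow_nonneg hy.le (-(t / (1 - t)))) (by ring)
  rw [Real.mul_rpow hx hy.le, ← Real.rpow_mul hy.le, mul_assoc,
    ← Real.rpow_add hy] at key
  rw [show t + -(t / (1 - t)) * (1 - t) = 0 by field_simp; ring, Real.rpow_zero, mul_one] at key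
  calc _ ≤ _ := mul_le_mul_of_nonneg_right key (overlap_nonneg hA.1 hB.1 i j)
    _ = _ := by ring

end Powers

/-! ### Hölder, Rotfel'd and Peierls inequalities for powers -/

section TraceInequalities

open scoped MatrixOrder Matrix.Norms.L2Operator

variable {ι : Type*} [Fintype ι] [DecidableEq ι] {A B : Matrix ι ι ℂ}

theorem mpow_neg_mul_mpow (hA : A.PosDef) (α : ℝ) : mpow A (-α) * mpow A α = 1 := by
  rw [mpow_mul_mpow, neg_add_cancel, mpow_zero_of_posDef hA]

theorem mpow_mul_mpow_neg (hA : A.PosDef) (α : ℝ) : mpow A α * mpow A (-α) = 1 := by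
  rw [mpow_mul_mpow, add_neg_cancel, mpow_zero_of_posDef hA]

theorem self_mul_mpow (hA : A.PosSemidef) (α : ℝ) : A * mpow A α = mpow A (1 + α) := by
  rw [← mpow_mul_mpow, mpow_one hA]

theorem qnew_nonneg (t : ℝ) (A B : Matrix ι ι ℂ) : 0 ≤ Qnew t A B := rtr_mpow_nonneg _ _

theorem qnew_smul (hA : A.PosSemidef) {c : ℝ} (hc : 0 < c) (t : ℝ) :
    Qnew t (c • A) B = c ^ t * Qnew t A B := by
  unfold Qnew
  rw [mul_smul_comm, smul_mul_assoc,
    mpow_smul (conj_posSemidef (mpow_isHermitian _ _) hA) hc, rtr_smul]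

theorem qnew_le_add_of_posDef (hA : A.PosSemidef) (hB : B.PosDef) {t : ℝ} (h0 : 0 < t)
    (h1 : t < 1) : Qnew t A B ≤ t * rtr A + (1 - t) * rtr B := by
  have h1' : 1 - t ≠ 0 := by linarith
  -- With `κ = (1-t)/(2t)`, the choice `B^(-2κ)` in Young's inequality cancels the sandwiching
  -- factors `B^κ`, and its power `-t/(1-t)` is `B` itself.
  have hY := rtr_mpow_le_young (conj_posSemidef (mpow_isHermitian B ((1 - t) / (2 * t))) hA)
    (mpow_posDef hB (-(2 * ((1 - t) / (2 * t))))) h0 h1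
  rw [mpow_mpow hB.1, show -(2 * ((1 - t) / (2 * t))) * -(t / (1 - t)) = 1 by field_simp,
    mpow_one hB.posSemidef, mul_assoc, mul_assoc, rtr_mul_comm, mul_assoc, mpow_mul_mpow,
    mul_assoc, mpow_mul_mpow, show (1 - t) / (2 * t) + (-(2 * ((1 - t) / (2 * t))) +
      (1 - t) / (2 * t)) = 0 by ring, mpow_zero_of_posDef hB, mul_one] at hY
  unfold Qnew
  rw [mul_assoc]
  exact hY

theorem qnew_le_add (hA : A.PosSemidef) (hB : B.PosSemidef) {t : ℝ} (h0 : 0 < t) (h1 : t < 1) :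
    Qnew t A B ≤ t * rtr A + (1 - t) * rtr B := by
  have hc := perturb_continuous B
  have := le_of_perturb_le
    (qnew_continuous (t := t) continuous_const hc (fun _ => hA.1) (perturb_isHermitian hB.1) h0 h1)
    (continuous_const.add (continuous_const.mul (rtr_continuous hc)))
    (fun ε hε => qnew_le_add_of_posDef hA (add_smul_one_posDef hB hε) h0 h1)
  simpa using this

/-- Hölder's inequality for the sandwiched quantity. -/
theorem qnew_le_rpow_mul_rpow (hA : A.PosSemidef) (hB : B.PosSemidef) {t : ℝ} (h0 : 0 < t)
    (h1 : t < 1) {u v : ℝ} (hu : 0 < u) (hv : 0 < v) (hAu : rtr A ≤ u) (hBv : rtr B ≤ v) :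
    Qnew t A B ≤ u ^ t * v ^ (1 - t) := by
  -- Rescaling `A` by `v / u` balances the two terms, so the additive bound becomes the
  -- multiplicative one.
  have h := qnew_le_add (hA.smul (div_pos hv hu).le : ((v / u) • A).PosSemidef) hB h0 h1
  rw [qnew_smul hA (div_pos hv hu), rtr_smul] at h
  have h2 : t * (v / u * rtr A) ≤ t * v := by
    have : v / u * rtr A ≤ v / u * u := mul_le_mul_of_nonneg_left hAu (div_pos hv hu).le
    rw [div_mul_cancel₀ _ hu.ne'] at this
    exact mul_le_mul_of_nonneg_left this h0.le
  have h3 : (1 - t) * rtr B ≤ (1 - t) * v := mul_le_mul_of_nonneg_left hBv (by linarith)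
  have h4 : (v / u) ^ t * Qnew t A B ≤ v := by linarith
  have h5 : (u ^ t * v ^ (1 - t)) = v / (v / u) ^ t := by
    rw [Real.div_rpow hv.le hu.le, Real.rpow_sub hv, Real.rpow_one]
    have := (Real.rpow_pos_of_pos hu t).ne'
    have := (Real.rpow_pos_of_pos hv t).ne'
    field_simp
  rw [h5, le_div_iff₀ (Real.rpow_pos_of_pos (div_pos hv hu) t), mul_comm]
  exact h4

theorem mpow_neg_le_mpow_neg (hA : A.PosDef) (hAB : A ≤ B) {α : ℝ} (h0 : 0 < α) (h1 : α ≤ 1) :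
    mpow B (-α) ≤ mpow A (-α) := by
  have hB : B.PosDef := by
    have := hA.add_posSemidef (Matrix.le_iff.1 hAB)
    rwa [add_sub_cancel] at this
  have h := mpow_le_mpow hA.posSemidef hAB h0 h1
  let a : (Matrix ι ι ℂ)ˣ := ⟨mpow A α, mpow A (-α), mpow_mul_mpow_neg hA α, mpow_neg_mul_mpow hA α⟩
  let b : (Matrix ι ι ℂ)ˣ := ⟨mpow B α, mpow B (-α), mpow_mul_mpow_neg hB α, mpow_neg_mul_mpow hB α⟩
  exact CStarAlgebra.inv_le_inv (a := a) (b := b) (mpow_posSemidef A α).nonneg h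

/-- With `S = A + B`, write `Tr S^t = Tr A S^(t-1) + Tr B S^(t-1)`. Since `t - 1 ∈ (-1, 0)`, the
power `t - 1` reverses order, so `S` may be replaced by `A` and by `B` respectively. -/
theorem rtr_mpow_add_le_of_posDef (hA : A.PosDef) (hB : B.PosDef) {t : ℝ} (h0 : 0 < t)
    (h1 : t < 1) : rtr (mpow (A + B) t) ≤ rtr (mpow A t) + rtr (mpow B t) := by
  have key : ∀ {C S : Matrix ι ι ℂ}, C.PosDef → C ≤ S → rtr (C * mpow S (t - 1)) ≤
      rtr (mpow C t) := by
    intro C S hC hCS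
    have h := mpow_neg_le_mpow_neg hC hCS (by linarith : 0 < 1 - t) (by linarith)
    rw [neg_sub] at h
    refine (rtr_mul_le_rtr_mul hC.posSemidef h).trans_eq ?_
    rw [self_mul_mpow hC.posSemidef, add_sub_cancel]
  have hS := hA.add hB
  have e : mpow (A + B) t = (A + B) * mpow (A + B) (t - 1) := by
    rw [self_mul_mpow hS.posSemidef, add_sub_cancel]
  rw [e, add_mul, rtr_add]
  refine add_le_add (key hA ?_) (key hB ?_)
  · exact le_add_of_nonneg_right hB.posSemidef.nonneg
  · exact le_add_of_nonneg_left hA.posSemidef.nonneg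

/-- Rotfel'd's inequality for powers. -/
theorem rtr_mpow_add_le (hA : A.PosSemidef) (hB : B.PosSemidef) {t : ℝ} (h0 : 0 < t)
    (h1 : t < 1) : rtr (mpow (A + B) t) ≤ rtr (mpow A t) + rtr (mpow B t) := by
  have cA := perturb_continuous A
  have cB := perturb_continuous B
  have := le_of_perturb_le
    (rtr_continuous (mpow_continuous (cA.add cB)
      (fun ε => (perturb_isHermitian hA.1 ε).add (perturb_isHermitian hB.1 ε)) h0))
    ((rtr_continuous (mpow_continuous cA (perturb_isHermitian hA.1) h0)).add
      (rtr_continuous (mpow_continuous cB (perturb_isHermitian hB.1) h0)))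
    (fun ε hε => rtr_mpow_add_le_of_posDef (add_smul_one_posDef hA hε)
      (add_smul_one_posDef hB hε) h0 h1)
  simpa using this

theorem mpow_zero_matrix {α : ℝ} : mpow (0 : Matrix ι ι ℂ) α = 0 := by
  unfold mpow
  rw [cfc_apply_zero]
  simp

theorem qnew_sum_le {κ : Type*} (s : Finset κ) {ρ : κ → Matrix ι ι ℂ}
    (hρ : ∀ i ∈ s, (ρ i).PosSemidef) {t : ℝ} (h0 : 0 < t) (h1 : t < 1) :
    Qnew t (∑ i ∈ s, ρ i) B ≤ ∑ i ∈ s, Qnew t (ρ i) B := by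
  classical
  induction s using Finset.induction_on with
  | empty => simp [Qnew, mpow_zero_matrix, rtr]
  | insert a s ha ih =>
    rw [Finset.sum_insert ha, Finset.sum_insert ha]
    have h2 : ∀ i ∈ s, (ρ i).PosSemidef := fun i hi => hρ i (Finset.mem_insert_of_mem hi)
    refine le_trans ?_ (add_le_add le_rfl (ih h2))
    unfold Qnew
    rw [mul_add, add_mul]
    exact rtr_mpow_add_le
      (conj_posSemidef (mpow_isHermitian _ _) (hρ a (Finset.mem_insert_self _ _)))
      (conj_posSemidef (mpow_isHermitian _ _) (posSemidef_sum s h2)) h0 h1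

theorem conj_eigenvectorUnitary_apply (hA : A.IsHermitian) (i : ι) :
    (((hA.eigenvectorUnitary : Matrix ι ι ℂ)ᴴ * A * (hA.eigenvectorUnitary : Matrix ι ι ℂ)) i i).re
      = hA.eigenvalues i := by
  have h := hA.conjStarAlgAut_star_eigenvectorUnitary
  rw [Unitary.conjStarAlgAut_star_apply] at h
  have := congrFun (congrFun h i) i
  rw [diagonal_apply_eq] at this
  exact congrArg Complex.re this

theorem rtr_eq_sum_diag (hA : A.IsHermitian) (M : Matrix ι ι ℂ) :
    rtr M = ∑ i, (((hA.eigenvectorUnitary : Matrix ι ι ℂ)ᴴ * M *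
      (hA.eigenvectorUnitary : Matrix ι ι ℂ)) i i).re := by
  have h := rtr_cfc_mul hA (fun _ => 1) M
  have h1 : cfc (fun _ : ℝ => (1 : ℝ)) A = 1 := cfc_const_one ℝ A hA.isSelfAdjoint
  simpa [h1] using h

/-- A Peierls-type inequality for fractional powers of compressions. -/
theorem rtr_conj_mpow_le {C G : Matrix ι ι ℂ} (hG : G.PosSemidef) (hC : C.IsHermitian)
    (hC1 : C * C ≤ 1) {s : ℝ} (h0 : 0 < s) (h1 : s ≤ 1) :
    rtr (C * mpow G s * C) ≤ rtr (mpow (C * G * C) s) := by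
  have hH := conj_posSemidef hC hG
  rw [rtr_eq_sum_diag hH.1, rtr_mpow hH h0]
  refine Finset.sum_le_sum fun i _ => ?_
  set U := (hH.1.eigenvectorUnitary : Matrix ι ι ℂ) with hU
  have hUC : (Uᴴ * C)ᴴ = C * U := by rw [conjTranspose_mul, conjTranspose_conjTranspose, hC.eq]
  have e : ∀ g : ℝ → ℝ, ((Uᴴ * (C * cfc g G * C) * U) i i).re = ∑ j, g (hG.1.eigenvalues j) *
      Complex.normSq ((Uᴴ * C * (hG.1.eigenvectorUnitary : Matrix ι ι ℂ)) i j) := by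
    intro g
    rw [← diag_mul_cfc_mul hG.1 g (Uᴴ * C) i, hUC]
    simp only [mul_assoc]
  set w := fun j => Complex.normSq ((Uᴴ * C * (hG.1.eigenvectorUnitary : Matrix ι ι ℂ)) i j)
    with hw
  have hw0 : ∀ j, 0 ≤ w j := fun j => Complex.normSq_nonneg _
  have e1 : ∑ j, w j ≤ 1 := by
    have h := e (fun _ => 1)
    have hc : cfc (fun _ : ℝ => (1 : ℝ)) G = 1 := cfc_const_one ℝ G hG.1.isSelfAdjoint
    rw [hc, mul_one] at h
    have hp := (Matrix.le_iff.1 hC1).conjTranspose_mul_mul_same U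
    have hd := (Complex.le_def.1 (hp.diag_nonneg (i := i))).1
    rw [mul_sub, sub_mul, mul_one, hU, conjTranspose_mul_eigenvectorUnitary, ← hU,
      Matrix.sub_apply, Matrix.one_apply_eq, Complex.sub_re, h] at hd
    simpa using hd
  have e2 : ∑ j, w j * hG.1.eigenvalues j = hH.1.eigenvalues i := by
    have h := e id
    rw [cfc_id_of_isHermitian hG.1, hU, conj_eigenvectorUnitary_apply, ← hU] at h
    rw [h]
    exact Finset.sum_congr rfl fun j _ => mul_comm _ _
  have e3 : ((Uᴴ * (C * mpow G s * C) * U) i i).re = ∑ j, w j * hG.1.eigenvalues j ^ s := by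
    rw [mpow, e]
    refine Finset.sum_congr rfl fun j _ => ?_
    rw [mul_comm]
    split_ifs with h
    · rfl
    · rw [le_antisymm (not_lt.1 h) (hG.eigenvalues_nonneg j), Real.zero_rpow h0.ne']
  rw [e3]
  -- Jensen for the concave power `s`, in weighted Hölder form because the weights `w` sum only to
  -- at most `1`.
  have hJ := Real.inner_le_weight_mul_Lp_of_nonneg Finset.univ (p := s⁻¹)
    ((one_le_inv₀ h0).2 h1) w (fun j => hG.1.eigenvalues j ^ s) hw0
    (fun j => Real.rpow_nonneg (hG.eigenvalues_nonneg j) s)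
  rw [inv_inv] at hJ
  refine hJ.trans ?_
  have e4 : ∑ j, w j * (hG.1.eigenvalues j ^ s) ^ s⁻¹ = hH.1.eigenvalues i := by
    rw [← e2]
    refine Finset.sum_congr rfl fun j _ => ?_
    rw [← Real.rpow_mul (hG.eigenvalues_nonneg j), mul_inv_cancel₀ h0.ne', Real.rpow_one]
  rw [e4]
  refine mul_le_of_le_one_left (Real.rpow_nonneg (hH.eigenvalues_nonneg i) s) ?_
  exact Real.rpow_le_one (Finset.sum_nonneg fun j _ => hw0 j) e1 (by linarith)

/-! ### Tests and their one-shot errors -/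

theorem one_sub_cfc (hA : A.IsHermitian) (f : ℝ → ℝ) :
    1 - cfc f A = cfc (fun x => 1 - f x) A := by
  rw [cfc_sub _ _ A (continuousOn_spectrum _ _) (continuousOn_spectrum _ _)]
  rw [cfc_const_one ℝ A hA.isSelfAdjoint]

theorem isTest_cfc (hA : A.IsHermitian) {f : ℝ → ℝ} (h0 : ∀ x, 0 ≤ f x) (h1 : ∀ x, f x ≤ 1) :
    IsTest (cfc f A) := by
  refine ⟨Matrix.nonneg_iff_posSemidef.1 (cfc_nonneg fun x _ => h0 x), ?_⟩
  rw [one_sub_cfc hA]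
  exact Matrix.nonneg_iff_posSemidef.1 (cfc_nonneg fun x _ => sub_nonneg.2 (h1 x))

/-- The test is `P = {W < 1}`, where `W = K X^(t-1) K` is built so that `Tr A W = Tr X^t` and `K W⁻¹
K = X^(1-t)`. The operator inequalities `1 - P ≤ W` and `P ≤ W⁻¹` then bound each error by `Tr X^t`.
-/
theorem exists_test_le_qnew (hA : A.PosDef) (hB : B.PosDef) {t : ℝ} (h0 : 0 < t)
    (h1 : t ≤ 1 / 2) : ∃ T : Matrix ι ι ℂ, IsTest T ∧
      rtr (A * (1 - T)) + rtr (B * T) ≤ 2 * Qnew t A B := by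
  have ht1 : 0 < 1 - t := by linarith
  set κ := (1 - t) / (2 * t) with hκ
  set K := mpow B κ with hK
  set X := K * A * K with hX
  have hKh : K.IsHermitian := mpow_isHermitian _ _
  have hKd : K.PosDef := mpow_posDef hB _
  have hXd : X.PosDef := conj_posDef hKd hA
  set W := K * mpow X (t - 1) * K with hW
  have hWd : W.PosDef := conj_posDef hKd (mpow_posDef hXd _)
  have hQ : Qnew t A B = rtr (mpow X t) := rfl
  set P := cfc (fun x : ℝ => if x < 1 then (1 : ℝ) else 0) W with hP
  have hPtest : IsTest P := isTest_cfc hWd.1 (fun x => by split_ifs <;> norm_num)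
    (fun x => by split_ifs <;> norm_num)
  have hPP : P * P = P := by
    rw [hP, ← cfc_mul _ _ W (continuousOn_spectrum _ _) (continuousOn_spectrum _ _)]
    exact cfc_congr fun x _ => by simp
  have hPW : 1 - P ≤ W := by
    rw [hP, one_sub_cfc hWd.1]
    conv_rhs => rw [← cfc_id_of_isHermitian hWd.1]
    refine cfc_mono (fun x hx => ?_) (continuousOn_spectrum _ _) (continuousOn_spectrum _ _)
    have := spectrum_pos hWd hx
    split_ifs with h
    · simpa using this.le
    · simpa using h
  have hPM : P ≤ mpow W (-1) := by
    refine cfc_mono (fun x hx => ?_) (continuousOn_spectrum _ _) (continuousOn_spectrum _ _)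
    have := spectrum_pos hWd hx
    rw [if_pos this, Real.rpow_neg_one]
    split_ifs with h
    · exact (one_le_inv₀ this).2 h.le
    · exact (inv_pos.2 this).le
  have hKi : mpow B (-κ) * K = 1 := mpow_neg_mul_mpow hB κ
  have hKi' : K * mpow B (-κ) = 1 := mpow_mul_mpow_neg hB κ
  have hM : mpow W (-1) = mpow B (-κ) * mpow X (1 - t) * mpow B (-κ) := by
    have h2 : W * (mpow B (-κ) * mpow X (1 - t) * mpow B (-κ)) = 1 := by
      calc _ = K * mpow X (t - 1) * (K * mpow B (-κ)) * mpow X (1 - t) * mpow B (-κ) := by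
            rw [hW]; simp only [mul_assoc]
        _ = K * (mpow X (t - 1) * mpow X (1 - t)) * mpow B (-κ) := by
            rw [hKi', mul_one]; simp only [mul_assoc]
        _ = 1 := by
            rw [mpow_mul_mpow, show t - 1 + (1 - t) = 0 by ring, mpow_zero_of_posDef hXd, mul_one,
              hKi']
    have h3 : mpow W (-1) * W = 1 := by
      have := mpow_neg_mul_mpow hWd 1
      rwa [mpow_one hWd.posSemidef] at this
    exact left_inv_eq_right_inv h3 h2
  have hKM : K * mpow W (-1) * K = mpow X (1 - t) := by
    rw [hM]
    calc _ = K * mpow B (-κ) * mpow X (1 - t) * (mpow B (-κ) * K) := by simp only [mul_assoc]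
      _ = _ := by rw [hKi, hKi', one_mul, mul_one]
  refine ⟨P, hPtest, ?_⟩
  have hXX : X * mpow X (t - 1) = mpow X t := by
    rw [self_mul_mpow hXd.posSemidef, add_sub_cancel]
  have b1 : rtr (A * (1 - P)) ≤ Qnew t A B := by
    refine (rtr_mul_le_rtr_mul hA.posSemidef hPW).trans_eq ?_
    rw [hQ, ← hXX, hW, hX, ← mul_assoc, rtr_mul_comm]
    simp only [mul_assoc]
  have b2 : rtr (B * P) ≤ Qnew t A B := by
    -- The exponent for which `B = (K²)^s` and `(X^(1-t))^s = X^t`. Here `t ≤ 1/2` enters: it gives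
    -- `s ≤ 1`, needed both for the Peierls inequality and for operator monotonicity.
    set s := t / (1 - t) with hs
    have hs0 : 0 < s := div_pos h0 ht1
    have hs1 : s ≤ 1 := (div_le_one ht1).2 (by linarith)
    have hBK : B = mpow (K * K) s := by
      rw [hK, mpow_mul_mpow, mpow_mpow hB.1]
      conv_lhs => rw [← mpow_one hB.posSemidef]
      congr 1
      rw [hκ, hs]
      field_simp
      ring
    have hPh : P.IsHermitian := hPtest.1.1
    have hKK : (K * K).PosSemidef := by
      rw [hK, mpow_mul_mpow]; exact mpow_posSemidef _ _
    have hKP : (K * P * K).PosSemidef := conj_posSemidef hKh hPtest.1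
    calc rtr (B * P) = rtr (P * mpow (K * K) s * P) := by
          rw [← hBK, rtr_mul_comm (P * B), ← mul_assoc, hPP, rtr_mul_comm]
      _ ≤ rtr (mpow (P * (K * K) * P) s) := by
          refine rtr_conj_mpow_le hKK hPh ?_ hs0 hs1
          rw [hPP, Matrix.le_iff]
          exact hPtest.2
      _ = rtr (mpow (K * P * K) s) := by
          have := rtr_mpow_conj_comm (C := K * P) s
          rw [conjTranspose_mul, hPh.eq, hKh.eq] at this
          rw [show P * (K * K) * P = P * K * (K * P) by simp only [mul_assoc], this,
            show K * P * (P * K) = K * (P * P) * K by simp only [mul_assoc], hPP]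
      _ ≤ rtr (mpow (mpow X (1 - t)) s) := by
          refine rtr_mono (mpow_le_mpow hKP ?_ hs0 hs1)
          rw [← hKM]
          exact conj_mono hKh hPM
      _ = Qnew t A B := by
          rw [mpow_mpow hXd.1, hs, mul_div_cancel₀ _ ht1.ne', hQ]
  linarith

/-- Optimality of the Neyman–Pearson test. -/
theorem posProj_error_le (hA : A.IsHermitian) (hB : B.IsHermitian) {T : Matrix ι ι ℂ}
    (hT : IsTest T) : rtr (A * (1 - posProj (A - B))) + rtr (B * posProj (A - B)) ≤
      rtr (A * (1 - T)) + rtr (B * T) := by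
  have hD := hA.sub hB
  set D := A - B with hDdef
  -- The total error is `Tr A - Tr S D`, and `Tr T D ≤ Tr T D₊ ≤ Tr D₊` for every test `T`, with
  -- equality at the projection.
  have e1 : ∀ S : Matrix ι ι ℂ, rtr (A * (1 - S)) + rtr (B * S) = rtr A - rtr (S * D) := by
    intro S
    rw [rtr_mul_comm S, hDdef, mul_sub, sub_mul, rtr_sub, rtr_sub, mul_one]
    ring
  rw [e1, e1]
  have e2 : posProj D * D = cfc (fun x : ℝ => max x 0) D := by
    unfold posProj
    conv_lhs => enter [2]; rw [← cfc_id_of_isHermitian hD]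
    rw [← cfc_mul _ _ D (continuousOn_spectrum _ _) (continuousOn_spectrum _ _)]
    refine cfc_congr fun x _ => ?_
    by_cases h : 0 < x
    · simp [h, h.le]
    · simp [h, not_lt.1 h]
  have e3 : D ≤ cfc (fun x : ℝ => max x 0) D := by
    conv_lhs => rw [← cfc_id_of_isHermitian hD]
    exact cfc_mono (fun x _ => le_max_left _ _) (continuousOn_spectrum _ _)
      (continuousOn_spectrum _ _)
  have hp : (cfc (fun x : ℝ => max x 0) D).PosSemidef :=
    Matrix.nonneg_iff_posSemidef.1 (cfc_nonneg fun x _ => le_max_right _ _)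
  have h4 := rtr_mul_le_rtr_mul hT.1 e3
  have h5 := rtr_mul_le_rtr_mul hp (Matrix.le_iff.2 hT.2)
  rw [mul_one, rtr_mul_comm] at h5
  rw [e2]
  linarith

/-- Audenaert's inequality for the Neyman–Pearson test. -/
theorem posProj_error_le_qold (hA : A.PosSemidef) (hB : B.PosSemidef) {t : ℝ} (h0 : 0 < t)
    (h1 : t < 1) : rtr (A * (1 - posProj (A - B))) + rtr (B * posProj (A - B)) ≤ Qold t A B := by
  have hD := hA.1.sub hB.1
  set D := A - B with hDdef
  set E := cfc (fun x : ℝ => max x 0) D with hE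
  have e1 : rtr (A * (1 - posProj D)) + rtr (B * posProj D) = rtr A - rtr (posProj D * D) := by
    rw [rtr_mul_comm (posProj D), hDdef, mul_sub, sub_mul, rtr_sub, rtr_sub, mul_one]
    ring
  have e2 : posProj D * D = E := by
    unfold posProj
    conv_lhs => enter [2]; rw [← cfc_id_of_isHermitian hD]
    rw [hE, ← cfc_mul _ _ D (continuousOn_spectrum _ _) (continuousOn_spectrum _ _)]
    refine cfc_congr fun x _ => ?_
    by_cases h : 0 < x
    · simp [h, h.le]
    · simp [h, not_lt.1 h]
  have e3 : D ≤ E := by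
    conv_lhs => rw [← cfc_id_of_isHermitian hD]
    exact cfc_mono (fun x _ => le_max_left _ _) (continuousOn_spectrum _ _)
      (continuousOn_spectrum _ _)
  have hEp : E.PosSemidef :=
    Matrix.nonneg_iff_posSemidef.1 (cfc_nonneg fun x _ => le_max_right _ _)
  have hC : (B + E).PosSemidef := hB.add hEp
  have hAC : A ≤ B + E := by
    have := add_le_add_right e3 B
    rwa [hDdef, add_sub_cancel] at this
  have hBC : B ≤ B + E := le_add_of_nonneg_right hEp.nonneg
  have ht : 0 < 1 - t := by linarith
  have split : ∀ {M : Matrix ι ι ℂ}, M.PosSemidef → rtr (mpow M t * mpow M (1 - t)) = rtr M := by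
    intro M hM
    rw [mpow_mul_mpow, show t + (1 - t) = 1 by ring, mpow_one hM]
  -- With `C = B + E` dominating both `A` and `B`, the chain is `Tr A - Tr A^t B^(1-t) ≤ Tr A^t
  -- (C^(1-t) - B^(1-t)) ≤ Tr C^t (C^(1-t) - B^(1-t)) ≤ Tr C - Tr B = Tr E`.
  have s1 := rtr_mul_le_rtr_mul (mpow_posSemidef A t)
    (mpow_le_mpow hA hAC ht (by linarith : 1 - t ≤ 1))
  have hBCt := mpow_le_mpow hB hBC ht (by linarith : 1 - t ≤ 1)
  have s2 := rtr_mul_le_rtr_mul (Matrix.le_iff.1 hBCt) (mpow_le_mpow hA hAC h0 h1.le)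
  have s3 := rtr_mul_le_rtr_mul (mpow_posSemidef B (1 - t)) (mpow_le_mpow hB hBC h0 h1.le)
  rw [rtr_mul_comm _ (mpow A t), rtr_mul_comm _ (mpow (B + E) t), mul_sub, mul_sub, rtr_sub,
    rtr_sub, split hC] at s2
  rw [rtr_mul_comm _ (mpow B t), rtr_mul_comm _ (mpow (B + E) t), split hB] at s3
  rw [split hA] at s1
  rw [e1, e2]
  rw [rtr_add] at s2
  unfold Qold
  linarith

end TraceInequalities

/-! ### The Araki–Lieb–Thirring inequality and the sandwiched error bound -/

section ArakiLiebThirring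

open scoped MatrixOrder Matrix.Norms.L2Operator

variable {ι : Type*} [Fintype ι] [DecidableEq ι] {A B : Matrix ι ι ℂ}

/-- Comparison of the elementary operator monotone functions `x / (s + x)` implies comparison of
the fractional powers. -/
theorem sum_mul_rpow_le_sum_mul_rpow.{u} {κ κ' : Type u} (s : Finset κ) (s' : Finset κ')
    {w x : κ → ℝ} {w' x' : κ' → ℝ} (hx : ∀ i, 0 ≤ x i) (hx' : ∀ i, 0 ≤ x' i) {q : ℝ}
    (hq : q ∈ Set.Ioo (0 : ℝ) 1)
    (h : ∀ c > 0, ∑ i ∈ s', w' i * (x' i / (c + x' i)) ≤ ∑ i ∈ s, w i * (x i / (c + x i))) :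
    ∑ i ∈ s', w' i * x' i ^ q ≤ ∑ i ∈ s, w i * x i ^ q := by
  -- `x^q` is an integral over `c > 0` of positive multiples of `x / (c + x)`, so the hypothesis is
  -- integrated in `c`.
  obtain ⟨μ, hμ⟩ := Real.exists_measure_rpow_eq_integral_rpowIntegrand₀₁ hq
  have rep : ∀ {κ : Type u} (s : Finset κ) (w x : κ → ℝ), (∀ i, 0 ≤ x i) →
      MeasureTheory.Integrable (fun c => ∑ i ∈ s, w i * Real.rpowIntegrand₀₁ q c (x i))
        (μ.restrict (Set.Ioi 0)) ∧
      ∑ i ∈ s, w i * x i ^ q = ∫ c in Set.Ioi 0,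
        ∑ i ∈ s, w i * Real.rpowIntegrand₀₁ q c (x i) ∂μ := by
    intro κ s w x hx
    have hi : ∀ i ∈ s, MeasureTheory.Integrable
        (fun c => w i * Real.rpowIntegrand₀₁ q c (x i)) (μ.restrict (Set.Ioi 0)) :=
      fun i _ => ((hμ (x i) (hx i)).1).const_mul (w i)
    refine ⟨MeasureTheory.integrable_finsetSum s hi, ?_⟩
    rw [MeasureTheory.integral_finsetSum s hi]
    refine Finset.sum_congr rfl fun i _ => ?_
    rw [MeasureTheory.integral_const_mul, ← (hμ (x i) (hx i)).2]
  obtain ⟨i1, e1⟩ := rep s w x hx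
  obtain ⟨i2, e2⟩ := rep s' w' x' hx'
  rw [e1, e2]
  refine MeasureTheory.setIntegral_mono_on i2 i1 measurableSet_Ioi fun c hc => ?_
  have hc : 0 < c := hc
  have e : ∀ {κ : Type u} (s : Finset κ) (w x : κ → ℝ), (∀ i, 0 ≤ x i) →
      ∑ i ∈ s, w i * Real.rpowIntegrand₀₁ q c (x i) =
        c ^ (q - 1) * ∑ i ∈ s, w i * (x i / (c + x i)) := by
    intro κ s w x hx
    rw [Finset.mul_sum]
    refine Finset.sum_congr rfl fun i _ => ?_
    rw [Real.rpowIntegrand₀₁_eq_pow_div hq hc.le (hx i)]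
    ring
  rw [e s w x hx, e s' w' x' hx']
  exact mul_le_mul_of_nonneg_left (h c hc) (Real.rpow_pos_of_pos hc _).le

theorem rtr_unitary_diagonal_conj {U : Matrix ι ι ℂ} (hU : Uᴴ * U = 1) (z : ι → ℝ)
    (M : Matrix ι ι ℂ) :
    rtr (M * ((U * diagonal (fun l => (z l : ℂ)) * Uᴴ) *
      (U * diagonal (fun l => (z l : ℂ)) * Uᴴ))) = ∑ l, z l ^ 2 * ((Uᴴ * M * U) l l).re := by
  have e : (U * diagonal (fun l => (z l : ℂ)) * Uᴴ) * (U * diagonal (fun l => (z l : ℂ)) * Uᴴ) =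
      U * (diagonal (fun l => ((z l : ℂ) * (z l : ℂ))) * Uᴴ) := by
    calc _ = U * diagonal (fun l => (z l : ℂ)) * (Uᴴ * U) * (diagonal (fun l => (z l : ℂ)) * Uᴴ) :=
          by simp only [mul_assoc]
      _ = _ := by
          rw [hU, mul_one, mul_assoc, ← mul_assoc (diagonal _), diagonal_mul_diagonal]
  rw [e, ← mul_assoc, rtr_mul_comm, mul_assoc, ← mul_assoc Uᴴ, rtr, Matrix.trace, Complex.re_sum]
  refine Finset.sum_congr rfl fun l _ => ?_
  rw [diag_apply, Matrix.diagonal_mul, ← Complex.ofReal_mul, Complex.re_ofReal_mul]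
  ring

theorem conj_diag_pos {M U : Matrix ι ι ℂ} (hM : M.PosDef) (hU : IsUnit U) (l : ι) :
    0 < ((Uᴴ * M * U) l l).re := by
  have := (IsUnit.posDef_star_left_conjugate_iff hU).2 hM
  exact (Complex.lt_def.1 this.diag_pos).1

/-- Joint convexity, in the form of a pinching inequality in the eigenbasis of `K`, of
`(V, A) ↦ Tr V ^ (-q) K A ^ (1 + q) K`. -/
theorem pinching_le {V K : Matrix ι ι ℂ} (hV : V.PosDef) (hA : A.PosDef) (hK : K.IsHermitian)
    {q : ℝ} (hq : q ∈ Set.Ioo (0 : ℝ) 1) :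
    ∑ l, hK.eigenvalues l ^ 2 *
      (((hK.eigenvectorUnitary : Matrix ι ι ℂ)ᴴ * A *
        (hK.eigenvectorUnitary : Matrix ι ι ℂ)) l l).re *
      ((((hK.eigenvectorUnitary : Matrix ι ι ℂ)ᴴ * A *
        (hK.eigenvectorUnitary : Matrix ι ι ℂ)) l l).re /
       (((hK.eigenvectorUnitary : Matrix ι ι ℂ)ᴴ * V *
        (hK.eigenvectorUnitary : Matrix ι ι ℂ)) l l).re) ^ q ≤
    rtr (mpow V (-q) * (K * mpow A (1 + q) * K)) := by
  set U := (hK.eigenvectorUnitary : Matrix ι ι ℂ) with hU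
  have hUU : Uᴴ * U = 1 := conjTranspose_mul_eigenvectorUnitary hK
  have hUunit : IsUnit U := IsUnit.of_mul_eq_one_right _ hUU
  set k := hK.eigenvalues
  set α := fun l => ((Uᴴ * A * U) l l).re with hα
  set β := fun l => ((Uᴴ * V * U) l l).re with hβ
  have hαp : ∀ l, 0 < α l := conj_diag_pos hA hUunit
  have hβp : ∀ l, 0 < β l := conj_diag_pos hV hUunit
  set a := hA.1.eigenvalues with ha
  set v := hV.1.eigenvalues with hv
  have hap : ∀ j, 0 < a j := hA.eigenvalues_pos
  have hvp : ∀ j, 0 < v j := hV.eigenvalues_pos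
  set n : Matrix ι ι ℂ → ι → ι → ℝ := fun Z i j =>
    Complex.normSq (((hV.1.eigenvectorUnitary : Matrix ι ι ℂ)ᴴ * Z *
      (hA.1.eigenvectorUnitary : Matrix ι ι ℂ)) i j) with hn
  have hrhs : rtr (mpow V (-q) * (K * mpow A (1 + q) * K)) =
      ∑ ij : ι × ι, (a ij.2 * n K ij.1 ij.2) * (a ij.2 / v ij.1) ^ q := by
    have h := rtr_cfc_mul_cfc hV.1 hA.1 (fun x : ℝ => if 0 < x then x ^ (-q) else 0)
      (fun x : ℝ => if 0 < x then x ^ (1 + q) else 0) K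
    rw [hK.eq] at h
    refine h.trans ?_
    rw [Fintype.sum_prod_type]
    refine Finset.sum_congr rfl fun i _ => Finset.sum_congr rfl fun j _ => ?_
    rw [if_pos (hvp i), if_pos (hap j), Real.div_rpow (hap j).le (hvp i).le,
      Real.rpow_add (hap j), Real.rpow_one, Real.rpow_neg (hvp i).le]
    simp only [hn]
    ring
  rw [hrhs]
  refine sum_mul_rpow_le_sum_mul_rpow Finset.univ Finset.univ
    (w := fun ij : ι × ι => a ij.2 * n K ij.1 ij.2) (x := fun ij => a ij.2 / v ij.1)
    (w' := fun l => k l ^ 2 * α l) (x' := fun l => α l / β l)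
    (fun ij => (div_pos (hap _) (hvp _)).le) (fun l => (div_pos (hαp l) (hβp l)).le) hq ?_
  intro c hc
  -- For fixed `c`, the right-hand sum is the maximum over matrices `Z` of the concave quadratic `∑
  -- (a |K|² - a |K - Z|² - c v |Z|²)`, entries being taken between the two eigenbases. The trial
  -- matrix `Y` is diagonal in the eigenbasis of `K` and optimal for the pinched problem, where it
  -- attains the left-hand sum.
  set y : ι → ℝ := fun l => k l * α l / (α l + c * β l) with hy
  set Y := U * diagonal (fun l => (y l : ℂ)) * Uᴴ with hY
  have hKU : K = U * diagonal (fun l => (k l : ℂ)) * Uᴴ := by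
    conv_lhs => rw [← cfc_id_of_isHermitian hK, cfc_eq_mul_diagonal_mul hK]
    rfl
  have hKY : K - Y = U * diagonal (fun l => ((k l - y l : ℝ) : ℂ)) * Uᴴ := by
    rw [hKU, hY, ← sub_mul, ← mul_sub, diagonal_sub]
    simp
  have herm : ∀ z : ι → ℝ, (U * diagonal (fun l => (z l : ℂ)) * Uᴴ)ᴴ =
      U * diagonal (fun l => (z l : ℂ)) * Uᴴ := by
    intro z
    rw [conjTranspose_mul, conjTranspose_mul, conjTranspose_conjTranspose, diagonal_conjTranspose,
      mul_assoc]
    congr 3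
    funext l
    simp
  have one_cfc : ∀ {M : Matrix ι ι ℂ}, M.IsHermitian → cfc (fun _ : ℝ => (1 : ℝ)) M = 1 :=
    fun hM => cfc_const_one ℝ _ hM.isSelfAdjoint
  have F1 : ∀ z : ι → ℝ, ∑ ij : ι × ι, a ij.2 *
      n (U * diagonal (fun l => (z l : ℂ)) * Uᴴ) ij.1 ij.2 = ∑ l, z l ^ 2 * α l := by
    intro z
    set Z := U * diagonal (fun l => (z l : ℂ)) * Uᴴ with hZ
    have h := rtr_cfc_mul_cfc hV.1 hA.1 (fun _ => 1) id Z
    rw [one_cfc hV.1, cfc_id_of_isHermitian hA.1, one_mul, hZ, herm, ← hZ] at h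
    rw [← rtr_unitary_diagonal_conj hUU z A, ← hZ, Fintype.sum_prod_type, ← mul_assoc,
      rtr_mul_comm (A * Z), ← mul_assoc, h]
    simp [hn, ha]
  have F2 : ∀ z : ι → ℝ, ∑ ij : ι × ι, v ij.1 *
      n (U * diagonal (fun l => (z l : ℂ)) * Uᴴ) ij.1 ij.2 = ∑ l, z l ^ 2 * β l := by
    intro z
    set Z := U * diagonal (fun l => (z l : ℂ)) * Uᴴ with hZ
    have h := rtr_cfc_mul_cfc hV.1 hA.1 id (fun _ => 1) Z
    rw [one_cfc hA.1, cfc_id_of_isHermitian hV.1, mul_one, hZ, herm, ← hZ] at h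
    rw [← rtr_unitary_diagonal_conj hUU z V, ← hZ, Fintype.sum_prod_type, h]
    simp [hn, hv]
  have point : ∀ ij : ι × ι, a ij.2 * n K ij.1 ij.2 - a ij.2 * n (K - Y) ij.1 ij.2
      - c * (v ij.1 * n Y ij.1 ij.2) ≤
      a ij.2 * n K ij.1 ij.2 * (a ij.2 / v ij.1 / (c + a ij.2 / v ij.1)) := by
    rintro ⟨i, j⟩
    simp only [hn]
    rw [mul_sub, sub_mul, Matrix.sub_apply]
    set x := ((hV.1.eigenvectorUnitary : Matrix ι ι ℂ)ᴴ * K *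
      (hA.1.eigenvectorUnitary : Matrix ι ι ℂ)) i j
    set m := ((hV.1.eigenvectorUnitary : Matrix ι ι ℂ)ᴴ * Y *
      (hA.1.eigenvectorUnitary : Matrix ι ι ℂ)) i j
    have h1 := hap j
    have h2 := hvp i
    have h3 : 0 < c * v i + a j := by positivity
    have e : a j / v i / (c + a j / v i) = a j / (c * v i + a j) := by
      field_simp
    rw [e, ← sub_nonneg]
    -- Completing the square in `m`.
    have e2 : a j * Complex.normSq x * (a j / (c * v i + a j)) -
        (a j * Complex.normSq x - a j * Complex.normSq (x - m) - c * (v i * Complex.normSq m)) =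
        ((a j * x.re - (c * v i + a j) * m.re) ^ 2 + (a j * x.im - (c * v i + a j) * m.im) ^ 2) /
          (c * v i + a j) := by
      simp only [Complex.normSq_apply, Complex.sub_re, Complex.sub_im]
      field_simp
      ring
    rw [e2]
    positivity
  calc ∑ l, k l ^ 2 * α l * (α l / β l / (c + α l / β l))
      = ∑ l, (k l ^ 2 * α l - (k l - y l) ^ 2 * α l - c * (y l ^ 2 * β l)) := by
        refine Finset.sum_congr rfl fun l _ => ?_
        have h1 := hαp l
        have h2 := hβp l
        have h3 : 0 < α l + c * β l := by positivity
        have e : α l / β l / (c + α l / β l) = α l / (α l + c * β l) := by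
          field_simp
          ring
        rw [e]
        simp only [hy]
        field_simp
        ring
    _ = ∑ ij : ι × ι, (a ij.2 * n K ij.1 ij.2 - a ij.2 * n (K - Y) ij.1 ij.2
      - c * (v ij.1 * n Y ij.1 ij.2)) := by
        rw [Finset.sum_sub_distrib, Finset.sum_sub_distrib, Finset.sum_sub_distrib,
          Finset.sum_sub_distrib, ← Finset.mul_sum, ← Finset.mul_sum, hKY, F1, hY, F2]
        conv_rhs => rw [hKU, F1]
    _ ≤ _ := Finset.sum_le_sum fun ij _ => point ij

/-- The Araki–Lieb–Thirring inequality `Q_t^{old} ≤ Q_t^{new}` for `1 / 2 < t < 1`. -/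
theorem qold_le_qnew (hA : A.PosDef) (hB : B.PosDef) {t : ℝ} (h0 : 1 / 2 < t) (h1 : t < 1) :
    Qold t A B ≤ Qnew t A B := by
  have ht : 0 < t := by linarith
  set q := (1 - t) / t with hq
  have hqI : q ∈ Set.Ioo (0 : ℝ) 1 :=
    ⟨div_pos (by linarith) ht, (div_lt_one ht).2 (by linarith)⟩
  set K := mpow B ((1 - t) / (2 * t)) with hK
  set X := K * A * K with hX
  have hKd : K.PosDef := mpow_posDef hB _
  have hXd : X.PosDef := conj_posDef hKd hA
  have hQ : Qnew t A B = rtr (mpow X t) := rfl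
  -- With `V = X^t` and `A^t` for `A`, the trace becomes `Tr X^(t-1) K A K = Tr X^t`. The
  -- requirement `q < 1` is exactly `t > 1/2`.
  have hP := pinching_le (mpow_posDef hXd t) (mpow_posDef hA t) hKd.1 hqI
  have htq : t * q = 1 - t := by rw [hq]; field_simp
  rw [mpow_mpow hXd.1, mpow_mpow hA.1, show t * (1 + q) = 1 by linear_combination htq,
    mpow_one hA.posSemidef, ← hX, rtr_mul_comm, self_mul_mpow hXd.posSemidef,
    show 1 + t * -q = t by linear_combination -htq, ← hQ] at hP
  set U := (hKd.1.eigenvectorUnitary : Matrix ι ι ℂ) with hU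
  have hUunit : IsUnit U := IsUnit.of_mul_eq_one_right _ (conjTranspose_mul_eigenvectorUnitary hKd.1)
  set k := hKd.1.eigenvalues with hk
  set α := fun l => ((Uᴴ * mpow A t * U) l l).re with hα
  set β := fun l => ((Uᴴ * mpow X t * U) l l).re with hβ
  have hαp : ∀ l, 0 < α l := conj_diag_pos (mpow_posDef hA t) hUunit
  have hβp : ∀ l, 0 < β l := conj_diag_pos (mpow_posDef hXd t) hUunit
  have hkp : ∀ l, 0 < k l := hKd.eigenvalues_pos
  have e1 : Qnew t A B = ∑ l, β l := by rw [hQ, rtr_eq_sum_diag hKd.1]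
  have e2 : Qold t A B = ∑ l, k l ^ (2 * t) * α l := by
    have : mpow B (1 - t) = mpow K (2 * t) := by
      rw [hK, mpow_mpow hB.1]
      congr 1
      field_simp
    rw [Qold, rtr_mul_comm, this, mpow, rtr_cfc_mul hKd.1]
    exact Finset.sum_congr rfl fun l _ => by rw [if_pos (hkp l)]
  have e3 : ∑ l, k l ^ (2 * t) * α l ≤
      t * ∑ l, k l ^ 2 * α l * (α l / β l) ^ q + (1 - t) * ∑ l, β l := by
    rw [Finset.mul_sum, Finset.mul_sum, ← Finset.sum_add_distrib]
    refine Finset.sum_le_sum fun l _ => ?_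
    have ha := hαp l
    have hb := hβp l
    have hk := hkp l
    have hd : 0 < α l / β l := div_pos ha hb
    -- The geometric mean of `k² α (α/β)^q` and `β` with weights `t`, `1 - t` is exactly `k^(2t) α`,
    -- because `t q = 1 - t`.
    have key := Real.geom_mean_le_arith_mean2_weighted ht.le (by linarith : 0 ≤ 1 - t)
      (by positivity : 0 ≤ k l ^ 2 * α l * (α l / β l) ^ q) hb.le (by ring)
    refine le_trans (le_of_eq ?_) key
    rw [Real.mul_rpow (by positivity) (by positivity), Real.mul_rpow (by positivity) ha.le,
      ← Real.rpow_mul hd.le, mul_comm q, htq, Real.div_rpow ha.le hb.le, ← Real.rpow_natCast,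
      ← Real.rpow_mul hk.le]
    have hb' := (Real.rpow_pos_of_pos hb (1 - t)).ne'
    have : α l = α l ^ t * α l ^ (1 - t) := by
      rw [← Real.rpow_add ha, add_sub_cancel, Real.rpow_one]
    push_cast
    conv_lhs => rw [this]
    field_simp
  rw [← e1, ← e2] at e3
  have e4 : t * ∑ l, k l ^ 2 * α l * (α l / β l) ^ q ≤ t * Qnew t A B :=
    mul_le_mul_of_nonneg_left hP ht.le
  linarith

/-- The error of the Neyman–Pearson test is controlled by the sandwiched quantity. -/
theorem posProj_error_le_qnew (hA : A.PosSemidef) (hB : B.PosSemidef) {t : ℝ} (h0 : 0 < t)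
    (h1 : t < 1) :
    rtr (A * (1 - posProj (A - B))) + rtr (B * posProj (A - B)) ≤ 2 * Qnew t A B := by
  have cA := perturb_continuous A
  have cB := perturb_continuous B
  have hdef : ∀ {C D : Matrix ι ι ℂ}, C.PosDef → D.PosDef →
      rtr (C * (1 - posProj (C - D))) + rtr (D * posProj (C - D)) ≤ 2 * Qnew t C D := by
    intro C D hC hD
    rcases le_or_gt t (1 / 2) with ht | ht
    · obtain ⟨T, hT, hTQ⟩ := exists_test_le_qnew hC hD h0 ht
      exact (posProj_error_le hC.1 hD.1 hT).trans hTQ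
    · have := posProj_error_le_qold hC.posSemidef hD.posSemidef h0 h1
      have h2 := qold_le_qnew hC hD ht h1
      have h3 := qnew_nonneg t C D
      linarith
  -- Adding the same `ε` to both operators leaves `A - B`, hence the projection, unchanged; no
  -- continuity of the discontinuous `posProj` is needed.
  have := le_of_perturb_le
    (f := fun ε : ℝ => rtr ((A + ε • 1) * (1 - posProj (A - B))) +
      rtr ((B + ε • 1) * posProj (A - B)))
    ((rtr_continuous (cA.mul continuous_const)).add (rtr_continuous (cB.mul continuous_const)))
    (continuous_const.mul
      (qnew_continuous cA cB (perturb_isHermitian hA.1) (perturb_isHermitian hB.1) h0 h1))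
    (fun ε hε => by
      have := hdef (add_smul_one_posDef hA hε) (add_smul_one_posDef hB hε)
      rwa [add_sub_add_right_eq_sub] at this)
  simpa using this

end ArakiLiebThirring

/-! ### The old Rényi quantity and its comparison with the new one -/

section OldDivergence

open scoped MatrixOrder Matrix.Norms.L2Operator

variable {ι : Type*} [Fintype ι] [DecidableEq ι] {ρ σ : Matrix ι ι ℂ}

theorem IsState.rtr_eq_one (hρ : IsState ρ) : rtr ρ = 1 := by simp [rtr, hρ.2]

theorem IsState.sum_eigenvalues (hρ : IsState ρ) : ∑ i, hρ.1.1.eigenvalues i = 1 := by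
  have := rtr_cfc hρ.1.1 id
  rw [cfc_id_of_isHermitian hρ.1.1, hρ.rtr_eq_one] at this
  exact this.symm

theorem IsState.eigenvalues_le_one (hρ : IsState ρ) (i : ι) : hρ.1.1.eigenvalues i ≤ 1 := by
  rw [← hρ.sum_eigenvalues]
  exact Finset.single_le_sum (fun j _ => hρ.1.eigenvalues_nonneg j) (Finset.mem_univ i)

theorem qold_one (hρ : IsState ρ) (hσ : IsState σ) (h : supp ρ ≤ supp σ) : Qold 1 ρ σ = 1 := by
  have hcol : ∀ j, ∃ v : ι → ℂ, σ *ᵥ v = ρ.col j := by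
    intro j
    have : ρ.col j ∈ supp ρ := ⟨Pi.single j 1, by simp⟩
    exact h this
  choose v hv using hcol
  -- Support inclusion, read column by column, factors `ρ` through `σ`; hence the projection `σ^0`
  -- fixes `ρ`.
  have hρσ : σ * (Matrix.of v)ᵀ = ρ := by
    ext i j
    have := congrFun (hv j) i
    simpa [Matrix.mul_apply, Matrix.mulVec, dotProduct] using this
  have hproj : mpow σ 0 * σ = σ := by
    conv_lhs => enter [2]; rw [← mpow_one hσ.1]
    rw [mpow_mul_mpow, zero_add, mpow_one hσ.1]
  rw [Qold, sub_self, mpow_one hρ.1, rtr_mul_comm, ← hρσ, ← mul_assoc, hproj, hρσ, hρ.rtr_eq_one]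

theorem qold_nonneg (t : ℝ) (ρ σ : Matrix ι ι ℂ) : 0 ≤ Qold t ρ σ :=
  rtr_mul_nonneg (mpow_posSemidef _ _) (mpow_posSemidef _ _)

theorem qold_eq_sum (hρ : ρ.PosSemidef) (hσ : σ.PosSemidef) {t : ℝ} (h1 : t < 1) :
    Qold t ρ σ = ∑ ij : ι × ι, (hρ.1.eigenvalues ij.1 * overlap hρ.1 hσ.1 ij.1 ij.2) *
      (hσ.1.eigenvalues ij.2 / hρ.1.eigenvalues ij.1) ^ (1 - t) := by
  rw [Qold, mpow, mpow, rtr_cfc_mul_cfc' hρ.1 hσ.1, Fintype.sum_prod_type]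
  refine Finset.sum_congr rfl fun i _ => Finset.sum_congr rfl fun j _ => ?_
  have ha := hρ.eigenvalues_nonneg i
  have hb := hσ.eigenvalues_nonneg j
  by_cases h : 0 < hρ.1.eigenvalues i
  · by_cases h' : 0 < hσ.1.eigenvalues j
    · dsimp only
      have e : hρ.1.eigenvalues i ^ t =
          hρ.1.eigenvalues i / hρ.1.eigenvalues i ^ (1 - t) := by
        rw [eq_div_iff (Real.rpow_pos_of_pos h _).ne', ← Real.rpow_add h, add_sub_cancel,
          Real.rpow_one]
      rw [if_pos h, if_pos h', Real.div_rpow hb ha, e]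
      ring
    · rw [if_neg h', le_antisymm (not_lt.1 h') hb, zero_div, Real.zero_rpow (by linarith)]
      ring
  -- The weight contains the vanishing eigenvalue of `ρ`, so the quotient by zero is harmless.
  · rw [if_neg h, le_antisymm (not_lt.1 h) ha]
    ring

/-- Monotonicity in `t` of the Rényi divergence `D_t^{old}` below `1`. -/
theorem qold_le_rpow (hρ : IsState ρ) (hσ : IsState σ) {x t : ℝ} (hxt : x ≤ t)
    (h1 : t < 1) : Qold t ρ σ ≤ Qold x ρ σ ^ ((1 - t) / (1 - x)) := by
  have ht : 0 < 1 - t := by linarith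
  have hx : 0 < 1 - x := by linarith
  rw [qold_eq_sum hρ.1 hσ.1 h1, qold_eq_sum hρ.1 hσ.1 (hxt.trans_lt h1)]
  set w : ι × ι → ℝ := fun ij => hρ.1.1.eigenvalues ij.1 * overlap hρ.1.1 hσ.1.1 ij.1 ij.2
  set z : ι × ι → ℝ := fun ij => hσ.1.1.eigenvalues ij.2 / hρ.1.1.eigenvalues ij.1
  have hz : ∀ ij, 0 ≤ z ij := fun ij =>
    div_nonneg (hσ.1.eigenvalues_nonneg _) (hρ.1.eigenvalues_nonneg _)
  have hw : ∑ ij, w ij = 1 := by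
    rw [Fintype.sum_prod_type, ← hρ.sum_eigenvalues]
    refine Finset.sum_congr rfl fun i _ => ?_
    simp only [w]
    rw [← Finset.mul_sum, sum_overlap_right, mul_one]
  have h := Real.inner_le_weight_mul_Lp_of_nonneg Finset.univ (p := (1 - x) / (1 - t))
    ((one_le_div ht).2 (by linarith)) w (fun ij => z ij ^ (1 - t))
    (fun ij => mul_nonneg (hρ.1.eigenvalues_nonneg _) (overlap_nonneg _ _ _ _))
    (fun ij => Real.rpow_nonneg (hz ij) _)
  rw [hw, Real.one_rpow, one_mul, inv_div] at h
  refine h.trans_eq ?_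
  congr 1
  refine Finset.sum_congr rfl fun ij _ => ?_
  rw [← Real.rpow_mul (hz ij), mul_div_cancel₀ _ ht.ne']

theorem rtr_mpow_le_card (hρ : IsState ρ) {t : ℝ} (h0 : 0 < t) (h1 : t < 1) :
    rtr (mpow ρ t) ≤ (Fintype.card ι : ℝ) ^ (1 - t) := by
  rw [rtr_mpow hρ.1 h0]
  have h := Real.inner_le_weight_mul_Lp_of_nonneg Finset.univ (p := t⁻¹)
    ((one_le_inv₀ h0).2 h1.le) (fun _ : ι => 1) (fun i => hρ.1.1.eigenvalues i ^ t)
    (fun _ => zero_le_one) (fun i => Real.rpow_nonneg (hρ.1.eigenvalues_nonneg i) _)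
  have e : ∑ i, 1 * (hρ.1.1.eigenvalues i ^ t) ^ t⁻¹ = 1 := by
    refine Eq.trans (Finset.sum_congr rfl fun i _ => ?_) hρ.sum_eigenvalues
    rw [one_mul, ← Real.rpow_mul (hρ.1.eigenvalues_nonneg i), mul_inv_cancel₀ h0.ne', Real.rpow_one]
  rw [e, inv_inv, Real.one_rpow, mul_one] at h
  simpa using h

/-- A converse to the Araki–Lieb–Thirring inequality. -/
theorem qnew_le_of_qold_le (hρ : IsState ρ) (hσ : IsState σ) {t : ℝ} (h0 : 0 < t) (h1 : t < 1)
    {u v : ℝ} (hu : 0 < u) (hv : 0 < v) (hQ : Qold t ρ σ ≤ u) (hcard : (Fintype.card ι : ℝ) ≤ v) :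
    Qnew t ρ σ ≤ u ^ t * (v ^ (1 - t)) ^ (1 - t) := by
  have ht : 0 < 1 - t := by linarith
  set κ := (1 - t) / (2 * t) with hκ
  set K := mpow σ κ with hK
  set H := mpow ρ (1 / 2) with hH
  have hKh : Kᴴ = K := (mpow_isHermitian _ _).eq
  have hHh : Hᴴ = H := (mpow_isHermitian _ _).eq
  have hHH : H * H = ρ := by
    rw [hH, mpow_mul_mpow, show (1 : ℝ) / 2 + 1 / 2 = 1 by norm_num, mpow_one hρ.1]
  -- Eigenvalues of a state are at most `1`, and `2κ = (1-t)/t ≥ 1-t`.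
  have hle : mpow σ (κ + κ) ≤ mpow σ (1 - t) := by
    refine cfc_mono (fun x hx => ?_) (continuousOn_spectrum _ _) (continuousOn_spectrum _ _)
    rw [hσ.1.1.spectrum_real_eq_range_eigenvalues] at hx
    obtain ⟨i, rfl⟩ := hx
    split_ifs with h
    · refine Real.rpow_le_rpow_of_exponent_ge h (hσ.eigenvalues_le_one i) ?_
      rw [hκ, show (1 - t) / (2 * t) + (1 - t) / (2 * t) = (1 - t) / t by field_simp; ring,
        le_div_iff₀ h0]
      nlinarith
    · exact le_rfl
  have hHherm : H.IsHermitian := hHh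
  -- Since `(ρ^t)^κ = ρ^((1-t)/2)`, the operator `ρ^(1/2) σ^(1-t) ρ^(1/2)` is `Y` sandwiched by
  -- `(ρ^t)^κ`. Hölder then gives `(Tr Y)^t (Tr ρ^t)^(1-t)`, where `Tr Y` is the old quantity.
  set Y := mpow ρ (t / 2) * mpow σ (1 - t) * mpow ρ (t / 2) with hY
  have hYp : Y.PosSemidef := conj_posSemidef (mpow_isHermitian _ _) (mpow_posSemidef _ _)
  have hYQ : rtr Y = Qold t ρ σ := by
    rw [hY, rtr_mul_comm, ← mul_assoc, mpow_mul_mpow, add_halves, Qold]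
  have hconj : mpow (mpow ρ t) κ * Y * mpow (mpow ρ t) κ = H * mpow σ (1 - t) * H := by
    have e : mpow (mpow ρ t) κ * mpow ρ (t / 2) = H := by
      rw [mpow_mpow hρ.1.1, mpow_mul_mpow, hH, hκ]
      congr 1
      field_simp
      ring
    have e' : mpow ρ (t / 2) * mpow (mpow ρ t) κ = H := by
      rw [mpow_mpow hρ.1.1, mpow_mul_mpow, hH, hκ]
      congr 1
      field_simp
      ring
    calc _ = (mpow (mpow ρ t) κ * mpow ρ (t / 2)) * mpow σ (1 - t) *
          (mpow ρ (t / 2) * mpow (mpow ρ t) κ) := by rw [hY]; simp only [mul_assoc]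
      _ = _ := by rw [e, e']
  calc Qnew t ρ σ = rtr (mpow (H * mpow σ (κ + κ) * H) t) := by
        have := rtr_mpow_conj_comm (C := H * K) t
        rw [conjTranspose_mul, hKh, hHh] at this
        rw [Qnew, ← hκ, ← hK, ← hHH, show K * (H * H) * K = K * H * (H * K) by
          simp only [mul_assoc], this, ← mpow_mul_mpow, ← hK]
        simp only [mul_assoc]
    _ ≤ rtr (mpow (H * mpow σ (1 - t) * H) t) :=
        rtr_mono (mpow_le_mpow (conj_posSemidef hHherm (mpow_posSemidef _ _))
          (conj_mono hHherm hle) h0 h1.le)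
    _ = Qnew t Y (mpow ρ t) := by rw [Qnew, ← hκ, hconj]
    _ ≤ u ^ t * (v ^ (1 - t)) ^ (1 - t) := by
        refine qnew_le_rpow_mul_rpow hYp (mpow_posSemidef _ _) h0 h1 hu (Real.rpow_pos_of_pos hv _)
          (hYQ.trans_le hQ) ((rtr_mpow_le_card hρ h0 h1).trans ?_)
        exact Real.rpow_le_rpow (Nat.cast_nonneg _) hcard ht.le

end OldDivergence

/-! ### Exponential rates in the extended reals -/

section Rates

theorem elog_of_nonpos {x : ℝ} (hx : x ≤ 0) : elog x = ⊥ := by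
  rw [elog, ENNReal.log_ofReal, if_pos hx]

theorem elog_of_pos {x : ℝ} (hx : 0 < x) : elog x = (Real.log x : EReal) :=
  ENNReal.log_ofReal_of_pos hx

theorem eventually_le_exp_of_limsupRate_lt {x : ℕ → ℝ} {c : ℝ} (h : limsupRate x < (c : EReal)) :
    ∀ᶠ n : ℕ in atTop, x n ≤ Real.exp (n * c) := by
  have h' := eventually_lt_of_limsup_lt h
  filter_upwards [h', eventually_gt_atTop 0] with n hn hn0
  rcases le_or_gt (x n) 0 with hx | hx
  · exact hx.trans (Real.exp_pos _).le
  · have hn0 : (0 : ℝ) < n := Nat.cast_pos.2 hn0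
    rw [elog_of_pos hx, ← EReal.coe_mul, EReal.coe_lt_coe_iff, inv_mul_lt_iff₀ hn0] at hn
    exact ((Real.log_lt_iff_lt_exp hx).1 hn).le

theorem limsupRate_le_of_eventually_le {x : ℕ → ℝ} {C c : ℝ} (hC : 0 < C)
    (h : ∀ᶠ n : ℕ in atTop, x n ≤ C * Real.exp (n * c)) : limsupRate x ≤ (c : EReal) := by
  have hlim : Tendsto (fun n : ℕ => (((n : ℝ)⁻¹ * Real.log C + c : ℝ) : EReal)) atTop
      (𝓝 ((c : ℝ) : EReal)) := by
    refine (continuous_coe_real_ereal.tendsto _).comp ?_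
    have := (tendsto_inv_atTop_nhds_zero_nat (𝕜 := ℝ)).mul_const (Real.log C)
    simpa using this.add_const c
  rw [← hlim.limsup_eq]
  refine limsup_le_limsup ?_
  filter_upwards [h, eventually_gt_atTop 0] with n hn hn0
  have hn0 : (0 : ℝ) < n := Nat.cast_pos.2 hn0
  rcases le_or_gt (x n) 0 with hx | hx
  · rw [elog_of_nonpos hx, EReal.coe_mul_bot_of_pos (inv_pos.2 hn0)]
    exact bot_le
  · rw [elog_of_pos hx, ← EReal.coe_mul, EReal.coe_le_coe_iff]
    have := Real.log_le_log hx hn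
    rw [Real.log_mul hC.ne' (Real.exp_pos _).ne', Real.log_exp] at this
    calc (n : ℝ)⁻¹ * Real.log (x n) ≤ (n : ℝ)⁻¹ * (Real.log C + n * c) :=
          mul_le_mul_of_nonneg_left this (inv_pos.2 hn0).le
      _ = _ := by field_simp

theorem limsupRate_one : limsupRate (fun _ => 1) = 0 := by
  unfold limsupRate
  simp [elog_of_pos]

/-- Passes from real exponents `c > Ψ` to `Ψ` itself, including `Ψ = ⊥`, which occurs for instance
when all the `Q` vanish. -/
theorem sub_le_neg_of_forall {Ψ L : EReal} {b : ℝ}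
    (h : ∀ c : ℝ, Ψ < (c : EReal) → L ≤ ((c - b : ℝ) : EReal)) : (b : EReal) - Ψ ≤ -L := by
  rw [EReal.le_neg]
  refine EReal.le_of_forall_lt_iff_le.1 fun z hz => ?_
  have h2 : Ψ < ((z + b : ℝ) : EReal) := by
    induction Ψ with
    | bot => exact EReal.bot_lt_coe _
    | top => simp at hz
    | coe p =>
      norm_cast at hz ⊢
      linarith
  simpa using h _ h2

theorem coe_lt_div_iff_of_neg {p : EReal} {r s : ℝ} (hs : s < 0) :
    (r : EReal) < p / (s : EReal) ↔ p < ((r * s : ℝ) : EReal) := by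
  rw [EReal.div_eq_inv_mul, ← EReal.coe_inv]
  have hs' := inv_lt_zero.2 hs
  induction p with
  | bot =>
    rw [EReal.coe_mul_bot_of_neg hs']
    exact iff_of_true (EReal.coe_lt_top _) (EReal.bot_lt_coe _)
  | top => simp [EReal.coe_mul_top_of_neg hs']
  | coe p =>
    rw [← EReal.coe_mul, EReal.coe_lt_coe_iff, EReal.coe_lt_coe_iff, ← div_eq_inv_mul,
      lt_div_iff_of_neg hs]

theorem coe_le_div_of_neg {p : EReal} {r s : ℝ} (hs : s < 0) (h : p ≤ ((r * s : ℝ) : EReal)) :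
    (r : EReal) ≤ p / (s : EReal) := by
  refine EReal.ge_of_forall_gt_iff_ge.1 fun z hz => ?_
  refine ((coe_lt_div_iff_of_neg hs).2 (h.trans_lt ?_)).le
  norm_cast at hz ⊢
  exact mul_lt_mul_of_neg_right hz hs

end Rates

/-! ### Error exponents of the Neyman–Pearson tests and the direct rate -/

section Asymptotics

variable {ι : ℕ → Type*} [∀ n, Fintype (ι n)] [∀ n, DecidableEq (ι n)] {r : ℕ}
  {ρ : Fin r → ∀ n, Matrix (ι n) (ι n) ℂ} {σ : ∀ n, Matrix (ι n) (ι n) ℂ}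
  {N : ∀ n, Set (Matrix (ι n) (ι n) ℂ)}

theorem posProj_isTest {κ : Type*} [Fintype κ] [DecidableEq κ] {D : Matrix κ κ ℂ}
    (hD : D.IsHermitian) : IsTest (posProj D) :=
  isTest_cfc hD (fun x => by split_ifs <;> norm_num) (fun x => by split_ifs <;> norm_num)

theorem sum_posSemidef (hρ : ∀ i n, IsState (ρ i n)) (n : ℕ) : (∑ i, ρ i n).PosSemidef :=
  posSemidef_sum _ fun i _ => (hρ i n).1

theorem npTest_isTest (hρ : ∀ i n, IsState (ρ i n)) (hσ : ∀ n, IsState (σ n)) (n : ℕ) (a : ℝ) :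
    IsTest (npTest ρ σ n a) :=
  posProj_isTest ((((sum_posSemidef hρ n).smul (Real.exp_pos _).le :
    (Real.exp (-(n * a)) • (∑ i, ρ i n)).PosSemidef).1).sub (hσ n).1.1)

theorem typeII_nonneg {κ : Type*} [Fintype κ] [DecidableEq κ] {τ T : Matrix κ κ ℂ}
    (hτ : IsState τ) (hT : IsTest T) : 0 ≤ typeII τ T := rtr_mul_nonneg hτ.1 hT.1

theorem typeI_nonneg (hρ : ∀ i n, IsState (ρ i n)) (hN : ∀ n, N n = Set.range fun i => ρ i n)
    (n : ℕ) {T : Matrix (ι n) (ι n) ℂ} (hT : IsTest T) : 0 ≤ typeI (N n) T := by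
  refine Real.sSup_nonneg ?_
  rw [hN]
  rintro _ ⟨_, ⟨i, rfl⟩, rfl⟩
  exact rtr_mul_nonneg (hρ i n).1 hT.2

theorem typeI_le_sum (hr : 0 < r) (hρ : ∀ i n, IsState (ρ i n))
    (hN : ∀ n, N n = Set.range fun i => ρ i n)
    (n : ℕ) {T : Matrix (ι n) (ι n) ℂ} (hT : IsTest T) :
    typeI (N n) T ≤ rtr ((∑ i, ρ i n) * (1 - T)) := by
  refine csSup_le ?_ ?_
  · rw [hN]
    exact ⟨_, _, ⟨⟨0, hr⟩, rfl⟩, rfl⟩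
  rw [hN]
  rintro _ ⟨_, ⟨i, rfl⟩, rfl⟩
  rw [Finset.sum_mul, rtr_sum]
  exact Finset.single_le_sum (f := fun i => rtr (ρ i n * (1 - T)))
    (fun i _ => rtr_mul_nonneg (hρ i n).1 hT.2) (Finset.mem_univ i)

/-- The one-shot bound for `e^{-na} ∑ ρ_i` against `σ_n`. Homogeneity of degree `t` turns the
prefactor into `e^{-nat}`, and subadditivity splits the sum; dropping either error on the left
bounds the other. -/
theorem npTest_error_le (hr : 0 < r) (hρ : ∀ i n, IsState (ρ i n)) (hσ : ∀ n, IsState (σ n))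
    (hN : ∀ n, N n = Set.range fun i => ρ i n) (n : ℕ) (a : ℝ) {t : ℝ} (h0 : 0 < t) (h1 : t < 1) :
    Real.exp (-(n * a)) * typeI (N n) (npTest ρ σ n a) + typeII (σ n) (npTest ρ σ n a) ≤
      2 * (Real.exp (-(n * (a * t))) * ∑ i, Qnew t (ρ i n) (σ n)) := by
  have hS := sum_posSemidef hρ n
  have hT := npTest_isTest hρ hσ n a
  have h := posProj_error_le_qnew
    (hS.smul (Real.exp_pos (-(n * a))).le : (Real.exp (-(n * a)) • (∑ i, ρ i n)).PosSemidef)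
    (hσ n).1 h0 h1
  rw [qnew_smul hS (Real.exp_pos _), ← Real.exp_mul, smul_mul_assoc, rtr_smul,
    show -(n * a) * t = -((n : ℝ) * (a * t)) by ring] at h
  have h2 := mul_le_mul_of_nonneg_left
    (qnew_sum_le (B := σ n) Finset.univ (fun i _ => (hρ i n).1) h0 h1)
    (Real.exp_pos (-((n : ℝ) * (a * t)))).le
  have h3 := mul_le_mul_of_nonneg_left (typeI_le_sum hr hρ hN n hT) (Real.exp_pos (-(n * a))).le
  unfold npTest typeII at *
  linarith

theorem typeII_npTest_le (hr : 0 < r) (hρ : ∀ i n, IsState (ρ i n)) (hσ : ∀ n, IsState (σ n))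
    (hN : ∀ n, N n = Set.range fun i => ρ i n) (n : ℕ) (a : ℝ) {t c : ℝ} (h0 : 0 < t) (h1 : t < 1)
    (h : ∀ i, Qnew t (ρ i n) (σ n) ≤ Real.exp (n * c)) :
    typeII (σ n) (npTest ρ σ n a) ≤ 2 * r * Real.exp (n * (c - a * t)) := by
  have h2 := npTest_error_le hr hρ hσ hN n a h0 h1
  have h3 : 0 ≤ Real.exp (-(n * a)) * typeI (N n) (npTest ρ σ n a) :=
    mul_nonneg (Real.exp_pos _).le (typeI_nonneg hρ hN n (npTest_isTest hρ hσ n a))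
  have h4 : ∑ i, Qnew t (ρ i n) (σ n) ≤ r * Real.exp (n * c) := by
    simpa using Finset.sum_le_sum fun i (_ : i ∈ Finset.univ) => h i
  have h5 := mul_le_mul_of_nonneg_left h4 (Real.exp_pos (-((n : ℝ) * (a * t)))).le
  have e : Real.exp (n * (c - a * t)) = Real.exp (-((n : ℝ) * (a * t))) * Real.exp (n * c) := by
    rw [← Real.exp_add]; congr 1; ring
  rw [e]
  linarith

theorem typeI_npTest_le (hr : 0 < r) (hρ : ∀ i n, IsState (ρ i n)) (hσ : ∀ n, IsState (σ n))
    (hN : ∀ n, N n = Set.range fun i => ρ i n) (n : ℕ) (a : ℝ) {t c : ℝ} (h0 : 0 < t) (h1 : t < 1)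
    (h : ∀ i, Qnew t (ρ i n) (σ n) ≤ Real.exp (n * c)) :
    typeI (N n) (npTest ρ σ n a) ≤ 2 * r * Real.exp (n * (c - a * (t - 1))) := by
  have h2 := npTest_error_le hr hρ hσ hN n a h0 h1
  have h3 := typeII_nonneg (hσ n) (npTest_isTest hρ hσ n a)
  have h4 : ∑ i, Qnew t (ρ i n) (σ n) ≤ r * Real.exp (n * c) := by
    simpa using Finset.sum_le_sum fun i (_ : i ∈ Finset.univ) => h i
  have h5 := mul_le_mul_of_nonneg_left h4 (Real.exp_pos (-((n : ℝ) * (a * t)))).le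
  have e : Real.exp (n * (c - a * (t - 1))) =
      Real.exp (n * a) * (Real.exp (-((n : ℝ) * (a * t))) * Real.exp (n * c)) := by
    rw [← Real.exp_add, ← Real.exp_add]; congr 1; ring
  have h6 : Real.exp (-(n * a)) * typeI (N n) (npTest ρ σ n a) ≤
      2 * r * (Real.exp (-((n : ℝ) * (a * t))) * Real.exp (n * c)) := by linarith
  rw [Real.exp_neg, inv_mul_le_iff₀ (Real.exp_pos _)] at h6
  rw [e]
  linarith

theorem eventually_qnew_le_of_iSup_lt {t c : ℝ} (h : (⨆ i, psiNew (ρ i) σ t) < (c : EReal)) :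
    ∀ᶠ n : ℕ in atTop, ∀ i, Qnew t (ρ i n) (σ n) ≤ Real.exp (n * c) :=
  eventually_all.2 fun i => eventually_le_exp_of_limsupRate_lt ((le_iSup _ i).trans_lt h)

theorem limsupRate_typeI_le (hr : 0 < r) (hρ : ∀ i n, IsState (ρ i n)) (hσ : ∀ n, IsState (σ n))
    (hN : ∀ n, N n = Set.range fun i => ρ i n) (a : ℝ) :
    limsupRate (fun n => typeI (N n) (npTest ρ σ n a)) ≤
      -(⨆ t ∈ Set.Ioo (0 : ℝ) 1, (((a * (t - 1) : ℝ) : EReal) - ⨆ i, psiNew (ρ i) σ t)) := by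
  rw [EReal.le_neg]
  refine iSup₂_le fun t ht => sub_le_neg_of_forall fun c hc => ?_
  have hr' : (0 : ℝ) < 2 * r := by have : (0 : ℝ) < r := Nat.cast_pos.2 hr; linarith
  refine limsupRate_le_of_eventually_le hr' ?_
  filter_upwards [eventually_qnew_le_of_iSup_lt hc] with n hn
  exact typeI_npTest_le hr hρ hσ hN n a ht.1 ht.2 hn

theorem limsupRate_typeII_le (hr : 0 < r) (hρ : ∀ i n, IsState (ρ i n)) (hσ : ∀ n, IsState (σ n))
    (hN : ∀ n, N n = Set.range fun i => ρ i n) (a : ℝ) :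
    limsupRate (fun n => typeII (σ n) (npTest ρ σ n a)) ≤
      -(⨆ t ∈ Set.Ioo (0 : ℝ) 1, (((a * t : ℝ) : EReal) - ⨆ i, psiNew (ρ i) σ t)) := by
  rw [EReal.le_neg]
  refine iSup₂_le fun t ht => sub_le_neg_of_forall fun c hc => ?_
  have hr' : (0 : ℝ) < 2 * r := by have : (0 : ℝ) < r := Nat.cast_pos.2 hr; linarith
  refine limsupRate_le_of_eventually_le hr' ?_
  filter_upwards [eventually_qnew_le_of_iSup_lt hc] with n hn
  exact typeII_npTest_le hr hρ hσ hN n a ht.1 ht.2 hn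

theorem psiNew_nonpos {τ : ∀ n, Matrix (ι n) (ι n) ℂ} (hτ : ∀ n, IsState (τ n))
    (hσ : ∀ n, IsState (σ n)) {t : ℝ} (h0 : 0 < t) (h1 : t < 1) : psiNew τ σ t ≤ 0 := by
  have : limsupRate (fun n => Qnew t (τ n) (σ n)) ≤ ((0 : ℝ) : EReal) := by
    refine limsupRate_le_of_eventually_le one_pos (Eventually.of_forall fun n => ?_)
    have := qnew_le_add (hτ n).1 (hσ n).1 h0 h1
    rw [(hτ n).rtr_eq_one, (hσ n).rtr_eq_one] at this
    simp only [mul_zero, Real.exp_zero]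
    linarith
  simpa [psiNew] using this

theorem neg_iSup_le_neg (hρ : ∀ i n, IsState (ρ i n)) (hσ : ∀ n, IsState (σ n)) (a : ℝ) :
    -(⨆ t ∈ Set.Ioo (0 : ℝ) 1, (((a * t : ℝ) : EReal) - ⨆ i, psiNew (ρ i) σ t)) ≤
      ((-a : ℝ) : EReal) := by
  rw [EReal.coe_neg, EReal.neg_le_neg_iff]
  have hlim : Tendsto (fun t : ℝ => ((a * t : ℝ) : EReal)) (𝓝[<] 1) (𝓝 ((a : ℝ) : EReal)) := by
    refine (continuous_coe_real_ereal.tendsto _).comp ?_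
    have : Tendsto (fun t : ℝ => a * t) (𝓝 1) (𝓝 (a * 1)) := tendsto_id.const_mul a
    rw [mul_one] at this
    exact this.mono_left nhdsWithin_le_nhds
  refine le_of_tendsto hlim ?_
  filter_upwards [Ioo_mem_nhdsLT (zero_lt_one' ℝ)] with t ht
  refine le_trans ?_ (le_iSup₂ t ht)
  have : (⨆ i, psiNew (ρ i) σ t) ≤ 0 := iSup_le fun i => psiNew_nonpos (hρ i) hσ ht.1 ht.2
  calc ((a * t : ℝ) : EReal) = ((a * t : ℝ) : EReal) - 0 := by simp
    _ ≤ _ := EReal.sub_le_sub le_rfl this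

theorem isAchievable_of_eventually_qnew_le (hr : 0 < r) (hρ : ∀ i n, IsState (ρ i n))
    (hσ : ∀ n, IsState (σ n)) (hN : ∀ n, N n = Set.range fun i => ρ i n) {t R R' : ℝ} (h0 : 0 < t)
    (h1 : t < 1) (hR : 0 ≤ R) (hRR : R < R')
    (h : ∀ i, ∀ᶠ n : ℕ in atTop, Qnew t (ρ i n) (σ n) ≤ Real.exp (n * ((t - 1) * R'))) :
    IsAchievable N σ R := by
  refine ⟨hR, fun n => npTest ρ σ n R, fun n => npTest_isTest hρ hσ n R, ?_, ?_⟩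
  · have hneg : (t - 1) * R' - R * (t - 1) < 0 := by nlinarith
    have hlim : Tendsto (fun n : ℕ => 2 * r * Real.exp (n * ((t - 1) * R' - R * (t - 1)))) atTop
        (𝓝 0) := by
      have : Tendsto (fun n : ℕ => (n : ℝ) * ((t - 1) * R' - R * (t - 1))) atTop atBot :=
        tendsto_natCast_atTop_atTop.atTop_mul_const_of_neg hneg
      simpa using (Real.tendsto_exp_atBot.comp this).const_mul (2 * (r : ℝ))
    refine squeeze_zero' (Eventually.of_forall fun n =>
      typeI_nonneg hρ hN n (npTest_isTest hρ hσ n R)) ?_ hlim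
    filter_upwards [eventually_all.2 h] with n hn
    exact typeI_npTest_le hr hρ hσ hN n R h0 h1 hn
  · exact (limsupRate_typeII_le hr hρ hσ hN R).trans (neg_iSup_le_neg hρ hσ R)

theorem isAchievable_zero (hr : 0 < r) (hρ : ∀ i n, IsState (ρ i n)) (hσ : ∀ n, IsState (σ n))
    (hN : ∀ n, N n = Set.range fun i => ρ i n) : IsAchievable N σ 0 := by
  have hT : ∀ n, IsTest (1 : Matrix (ι n) (ι n) ℂ) := fun n =>
    ⟨PosSemidef.one, by rw [sub_self]; exact PosSemidef.zero⟩
  refine ⟨le_rfl, fun n => 1, hT, ?_, ?_⟩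
  · refine tendsto_const_nhds.congr fun n => le_antisymm (typeI_nonneg hρ hN n (hT n)) ?_
    refine (typeI_le_sum hr hρ hN n (hT n)).trans_eq ?_
    simp [rtr]
  · have : (fun n => typeII (σ n) (1 : Matrix (ι n) (ι n) ℂ)) = fun _ => 1 := by
      funext n
      rw [typeII, mul_one, (hσ n).rtr_eq_one]
    rw [this, limsupRate_one]
    simp

theorem le_directRate {R : ℝ} (h : IsAchievable N σ R) : (R : EReal) ≤ directRate N σ :=
  le_sSup ⟨R, h, rfl⟩

/-- To bound the direct rate from below it suffices to treat strictly smaller nonnegative rates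
with some room to spare. -/
theorem le_directRate_of_forall (hr : 0 < r) (hρ : ∀ i n, IsState (ρ i n))
    (hσ : ∀ n, IsState (σ n)) (hN : ∀ n, N n = Set.range fun i => ρ i n) {d : EReal}
    (h : ∀ R R' : ℝ, 0 ≤ R → R < R' → (R' : EReal) < d → IsAchievable N σ R) :
    d ≤ directRate N σ := by
  by_contra hlt
  rw [not_le] at hlt
  obtain ⟨R, hR1, hR2⟩ := EReal.lt_iff_exists_real_btwn.1 hlt
  obtain ⟨R', hR1', hR2'⟩ := EReal.lt_iff_exists_real_btwn.1 hR2
  -- The trivial test `T = 1` achieves rate `0`, so only nonnegative `R` need be considered.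
  have h0 : (0 : EReal) ≤ directRate N σ := by
    simpa using le_directRate (isAchievable_zero hr hρ hσ hN)
  have hR0 : 0 ≤ R := by
    have := h0.trans hR1.le
    exact_mod_cast this
  exact absurd (le_directRate (h R R' hR0 (by exact_mod_cast hR1') hR2')) (not_le.2 hR1)

theorem qnew_le_exp_of_lt_Dnew {κ : Type*} [Fintype κ] [DecidableEq κ] {τ ω : Matrix κ κ ℂ}
    (hτ : IsState τ) {t c : ℝ} (h0 : 0 < t) (h1 : t < 1) {n : ℕ} (hn : 0 < n)
    (h : (c : EReal) < (((n : ℝ)⁻¹ : ℝ) : EReal) * Dnew t τ ω) :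
    Qnew t τ ω ≤ Real.exp (n * ((t - 1) * c)) := by
  rcases le_or_gt (Qnew t τ ω) 0 with hQ | hQ
  · exact hQ.trans (Real.exp_pos _).le
  · have hn0 : (0 : ℝ) < n := Nat.cast_pos.2 hn
    have ht : t - 1 < 0 := by linarith
    rw [Dnew, if_pos (Or.inl ⟨h0, h1⟩), hτ.rtr_eq_one, elog_of_pos hQ, elog_of_pos one_pos,
      Real.log_one, ← EReal.coe_mul, ← EReal.coe_mul, ← EReal.coe_sub, ← EReal.coe_mul,
      EReal.coe_lt_coe_iff, mul_zero, sub_zero, lt_inv_mul_iff₀ hn0, ← div_eq_inv_mul,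
      lt_div_iff_of_neg ht] at h
    refine ((Real.log_le_iff_le_exp hQ).1 (h.le.trans_eq ?_))
    ring

theorem iSup_liminf_Dnew_le_directRate (hr : 0 < r) (hρ : ∀ i n, IsState (ρ i n))
    (hσ : ∀ n, IsState (σ n)) (hN : ∀ n, N n = Set.range fun i => ρ i n) :
    (⨆ t ∈ Set.Ioo (0 : ℝ) 1, ⨅ i, liminf (fun n : ℕ =>
      (((n : ℝ)⁻¹ : ℝ) : EReal) * Dnew t (ρ i n) (σ n)) atTop) ≤ directRate N σ := by
  refine iSup₂_le fun t ht => le_directRate_of_forall hr hρ hσ hN fun R R' hR hRR hR' => ?_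
  refine isAchievable_of_eventually_qnew_le hr hρ hσ hN ht.1 ht.2 hR hRR fun i => ?_
  filter_upwards [eventually_lt_of_lt_liminf (hR'.trans_le (iInf_le _ i)),
    eventually_gt_atTop 0] with n hn hn0
  exact qnew_le_exp_of_lt_Dnew (hρ i n) ht.1 ht.2 hn0 hn

/-! ### The left derivative at `1` as a lower bound for the direct rate -/

theorem psiOld_one {τ : ∀ n, Matrix (ι n) (ι n) ℂ} (hτ : ∀ n, IsState (τ n))
    (hσ : ∀ n, IsState (σ n)) (hsupp : ∀ n, supp (τ n) ≤ supp (σ n)) : psiOld τ σ 1 = 0 := by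
  rw [psiOld, funext fun n => qold_one (hτ n) (hσ n) (hsupp n), limsupRate_one]

theorem psiOld_div_mono {τ : ∀ n, Matrix (ι n) (ι n) ℂ} (hτ : ∀ n, IsState (τ n))
    (hσ : ∀ n, IsState (σ n)) {x t : ℝ} (hxt : x ≤ t) (h1 : t < 1) :
    psiOld τ σ x / ((x - 1 : ℝ) : EReal) ≤ psiOld τ σ t / ((t - 1 : ℝ) : EReal) := by
  have hx : 0 < 1 - x := by linarith
  have ht : 0 < 1 - t := by linarith
  refine EReal.ge_of_forall_gt_iff_ge.1 fun z hz => ?_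
  rw [coe_lt_div_iff_of_neg (by linarith)] at hz
  refine coe_le_div_of_neg (by linarith) (limsupRate_le_of_eventually_le one_pos ?_)
  filter_upwards [eventually_le_exp_of_limsupRate_lt hz] with n hn
  calc Qold t (τ n) (σ n) ≤ Qold x (τ n) (σ n) ^ ((1 - t) / (1 - x)) :=
        qold_le_rpow (hτ n) (hσ n) hxt h1
    _ ≤ Real.exp (n * (z * (x - 1))) ^ ((1 - t) / (1 - x)) :=
        Real.rpow_le_rpow (qold_nonneg _ _ _) hn (div_pos ht hx).le
    _ = 1 * Real.exp (n * (z * (t - 1))) := by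
        rw [← Real.exp_mul, one_mul]
        congr 1
        field_simp
        ring

/-- Since `ψ^{old}(1) = 0`, the difference quotient is `ψ^{old}(t)/(t-1)`. It is nondecreasing in
`t`, so its left limit is its supremum. -/
theorem hasLeftDeriv_psiOld {τ : ∀ n, Matrix (ι n) (ι n) ℂ} (hτ : ∀ n, IsState (τ n))
    (hσ : ∀ n, IsState (σ n)) (hsupp : ∀ n, supp (τ n) ≤ supp (σ n)) :
    HasLeftDeriv (psiOld τ σ) 1
      (⨆ t ∈ Set.Ioo (0 : ℝ) 1, psiOld τ σ t / ((t - 1 : ℝ) : EReal)) := by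
  unfold HasLeftDeriv
  simp only [psiOld_one hτ hσ hsupp, sub_zero]
  refine tendsto_order.2 ⟨fun a ha => ?_, fun b hb => ?_⟩
  · obtain ⟨x, hx⟩ := lt_iSup_iff.1 ha
    obtain ⟨hxI, hx⟩ := lt_iSup_iff.1 hx
    filter_upwards [Ioo_mem_nhdsLT hxI.2] with t ht
    exact hx.trans_le (psiOld_div_mono hτ hσ ht.1.le ht.2)
  · filter_upwards [Ioo_mem_nhdsLT (zero_lt_one' ℝ)] with t ht
    exact (le_iSup₂ (f := fun t (_ : t ∈ Set.Ioo (0 : ℝ) 1) =>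
      psiOld τ σ t / ((t - 1 : ℝ) : EReal)) t ht).trans_lt hb

theorem iInf_leftDeriv_le_directRate (hr : 0 < r) (hρ : ∀ i n, IsState (ρ i n))
    (hσ : ∀ n, IsState (σ n)) (hsupp : ∀ i n, supp (ρ i n) ≤ supp (σ n))
    (hN : ∀ n, N n = Set.range fun i => ρ i n)
    (hdim : limsupRate (fun n => (Fintype.card (ι n) : ℝ)) < ⊤) {d : Fin r → EReal}
    (hd : ∀ i, HasLeftDeriv (psiOld (ρ i) σ) 1 (d i)) : (⨅ i, d i) ≤ directRate N σ := by
  obtain ⟨c, hc, -⟩ := EReal.lt_iff_exists_real_btwn.1 hdim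
  have hcard := eventually_le_exp_of_limsupRate_lt hc
  refine le_directRate_of_forall hr hρ hσ hN fun R R' hR hRR hR' => ?_
  have ev1 : ∀ᶠ t in 𝓝[<] (1 : ℝ), ∀ i,
      (R' : EReal) < psiOld (ρ i) σ t / ((t - 1 : ℝ) : EReal) := by
    refine eventually_all.2 fun i => ?_
    have := hd i
    unfold HasLeftDeriv at this
    simp only [psiOld_one (hρ i) hσ (hsupp i), sub_zero] at this
    exact this.eventually_const_lt (hR'.trans_le (iInf_le _ i))
  -- The converse inequality yields the exponent `t(t-1)R' + (1-t)²c = (t-1)(tR' - (1-t)c)`. The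
  -- rate `tR' - (1-t)c` tends to `R' > R` as `t → 1`.
  have ev2 : ∀ᶠ t in 𝓝[<] (1 : ℝ), R < t * R' - (1 - t) * c := by
    have hcont : Continuous fun t : ℝ => t * R' - (1 - t) * c := by fun_prop
    have := (hcont.tendsto 1).mono_left (nhdsWithin_le_nhds (s := Set.Iio 1))
    simp only [one_mul, sub_self, zero_mul, sub_zero] at this
    exact this.eventually_const_lt hRR
  obtain ⟨t, h1, h2, ht⟩ := (ev1.and (ev2.and (Ioo_mem_nhdsLT (zero_lt_one' ℝ)))).exists
  refine isAchievable_of_eventually_qnew_le hr hρ hσ hN ht.1 ht.2 hR h2 fun i => ?_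
  have h3 := (coe_lt_div_iff_of_neg (by linarith [ht.2])).1 (h1 i)
  filter_upwards [eventually_le_exp_of_limsupRate_lt h3, hcard] with n hn hcn
  refine (qnew_le_of_qold_le (hρ i n) (hσ n) ht.1 ht.2 (Real.exp_pos _) (Real.exp_pos _) hn
    hcn).trans_eq ?_
  rw [← Real.exp_mul, ← Real.exp_mul, ← Real.exp_mul, ← Real.exp_add]
  congr 1
  ring

end Asymptotics

end QHT

theorem mainTheorem8 {ι : ℕ → Type*} [∀ n, Fintype (ι n)] [∀ n, DecidableEq (ι n)]
    (r : ℕ) (hr : 0 < r)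
    (ρ : Fin r → ∀ n, Matrix (ι n) (ι n) ℂ) (σ : ∀ n, Matrix (ι n) (ι n) ℂ)
    (hρ : ∀ i n, QHT.IsState (ρ i n)) (hσ : ∀ n, QHT.IsState (σ n))
    (hsupp : ∀ i n, QHT.supp (ρ i n) ≤ QHT.supp (σ n))
    (N : ∀ n, Set (Matrix (ι n) (ι n) ℂ)) (hN : ∀ n, N n = Set.range fun i => ρ i n) :
    (∀ a : ℝ,
      QHT.limsupRate (fun n => QHT.typeI (N n) (QHT.npTest ρ σ n a)) ≤
        -(⨆ t ∈ Set.Ioo (0 : ℝ) 1,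
            (((a * (t - 1) : ℝ) : EReal) - ⨆ i, QHT.psiNew (ρ i) σ t)) ∧
      QHT.limsupRate (fun n => QHT.typeII (σ n) (QHT.npTest ρ σ n a)) ≤
        -(⨆ t ∈ Set.Ioo (0 : ℝ) 1,
            (((a * t : ℝ) : EReal) - ⨆ i, QHT.psiNew (ρ i) σ t)) ∧
      -(⨆ t ∈ Set.Ioo (0 : ℝ) 1,
            (((a * t : ℝ) : EReal) - ⨆ i, QHT.psiNew (ρ i) σ t)) ≤ ((-a : ℝ) : EReal)) ∧
    (⨆ t ∈ Set.Ioo (0 : ℝ) 1, ⨅ i,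
        liminf (fun n : ℕ =>
          (((n : ℝ)⁻¹ : ℝ) : EReal) * QHT.Dnew t (ρ i n) (σ n)) atTop) ≤
      QHT.directRate N σ ∧
    (QHT.limsupRate (fun n => (Fintype.card (ι n) : ℝ)) < ⊤ →
      ∃ d : Fin r → EReal,
        (∀ i, QHT.HasLeftDeriv (QHT.psiOld (ρ i) σ) 1 (d i)) ∧
        (⨅ i, d i) ≤ QHT.directRate N σ) := by
  refine ⟨fun a => ⟨QHT.limsupRate_typeI_le hr hρ hσ hN a, QHT.limsupRate_typeII_le hr hρ hσ hN a,
    QHT.neg_iSup_le_neg hρ hσ a⟩, QHT.iSup_liminf_Dnew_le_directRate hr hρ hσ hN, fun hdim => ?_⟩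
  have hd := fun i => QHT.hasLeftDeriv_psiOld (hρ i) hσ (hsupp i)
  exact ⟨_, hd, QHT.iInf_leftDeriv_le_directRate hr hρ hσ hsupp hN hdim hd⟩
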